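/- Let $\Omega=(a,b)$ be a bounded interval, $T>0$, $0<\gamma<1$, $1<\alpha<2$, $K_{\gamma,\alpha}>0$. Write $(u,v)=\int_a^b u\,\overline{v}\,dx$ and $\|u\|^2=(u,u)$. Let $U:\Omega\to\mathbb R$ be integrable and $p\in\mathbb C$ with $\operatorname{Re}(pU(x))\ge 0$ on $\Omega$ (for example $p\geq 0$ and $U\ge 0$). Define the Caputo fractional substantial derivative $$ {}^SD_{*,t}^{\gamma}G(x,t)=\frac{e^{-pU(x)t}}{\Gamma(1-\gamma)}\int_0^t (t-s)^{-\gamma}\,e^{pU(x)s}\Big(\frac{\partial}{\partial s}+pU(x)\Big)G(x,s)\,ds, $$ and the bilinear (for complex-valued functions: sesquilinear) form $$ B(u,v)=\frac{\big({}_aD_x^{\alpha/2}u,\,{}_xD_b^{\alpha/2}v\big)+\big({}_xD_b^{\alpha/2}u,\,{}_aD_x^{\alpha/2}v\big)}{2\cos(\alpha\pi/2)}, $$ where, for $0<\sigma<1$, ${}_aD_x^{\sigma}u(x)=\frac1{\Gamma(1-\sigma)}\frac{d}{dx}\int_a^x (x-\xi)^{-\sigma}u(\xi)\,d\xi$ and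 ${}_xD_b^{\sigma}u(x)=\frac{-1}{\Gamma(1-\sigma)}\frac{d}{dx}\int_x^b(\xi-x)^{-\sigma}u(\xi)\,d\xi$ are the left and right Riemann–Liouville derivatives. For integers $d\ge 2$, $J\ge 0$ let $t_1\le t_2\le\cdots$ be the knots $0,\dots,0$ ($d$ times), $2^{-J},2\cdot2^{-J},\dots,1-2^{-J}$, $1,\dots,1$ ($d$ times), and let $S_J$ be the complex span of the B-splines $$\phi_{J,k}(x)=2^{J/2}(t_{k+d+1}-t_{k+1})\,[t_{k+1},\dots,t_{k+d+1}]_t\,\big(\max\{0,t-x\}\big)^{d-1},\qquad 1\le k\le 2^J+d-3,$$ transported from $(0,1)$ to $\Omega$ by the affine map, where $[\,\cdot\,]_t$ is the divided difference in $t$. Consider the Galerkin space semi-discrete scheme (model II): $G_J(\cdot,t)\in S_J$ for $0\le t\le T$, the coefficients of $G_J(\cdot,t)$ in the functions $\phi_{J,k}$ are absolutely continuous on $[0,T]$, and for a.e. $t\in(0,T)$ $$\big({}^SD_{*,t}^{\gamma}G_J,\,v\big)+K_{\gamma,\alpha}B(G_J,v)=(f,v)\qquad\forall v\in S_J,$$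 where $f\in L^2((0,T)\times\Omega)$. The initial value $G_J(0)\in S_J$ is a stable approximation of the initial datum $g\in L^2(\Omega)$, i.e. $\|G_J(0)\|\le M\|g\|$ with a fixed constant $M$ ($M=1$ if $G_J(0)=g$ or if $G_J(0)$ is the $L^2$-projection of $g$). **Theorem.** There is a constant $C>0$, depending only on $a,b,\alpha,\gamma,K_{\gamma,\alpha},T,M$ (and not on $d,J,p,U,g,f,G_J,t$), such that for every such $G_J$ and every $t\in[0,T]$ the left-hand integrand below is integrable on $(0,t)$ and $$\int_0^t\Big(\|G_J\|^2+K_{\gamma,\alpha}\,\operatorname{Re}B(G_J,G_J)\Big)\,ds\;\le\; C\Big(\|g\|^2+\int_0^t\|f\|^2\,ds\Big).$$ (The real part is superfluous, since $B(u,u)$ is real.) -/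

import Mathlib

open MeasureTheory Set

noncomputable section

namespace FeynmanKac

/-! ### `L²` inner product and norm on `Ω = (a, b)` -/

/-- The `L²(a, b)` inner product `(u, v) = ∫_a^b u(x) conj(v(x)) dx` (linear in `u`). -/
def l2Inner (a b : ℝ) (u v : ℝ → ℂ) : ℂ :=
  ∫ x in Ioo a b, u x * (starRingEnd ℂ) (v x)

/-- The `L²(a, b)` norm `‖u‖ = (∫_a^b |u(x)|² dx)^{1/2}`. -/
def l2Norm (a b : ℝ) (u : ℝ → ℂ) : ℝ :=
  Real.sqrt (∫ x in Ioo a b, ‖u x‖ ^ 2)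

/-! ### Fractional derivatives -/

/-- Left Riemann–Liouville derivative of order `s ∈ (0, 1)` with base point `a`:
`1/Γ(1-s) · d/dx ∫_a^x (x-ξ)^{-s} u(ξ) dξ`. -/
def leftRL (a s : ℝ) (u : ℝ → ℂ) (x : ℝ) : ℂ :=
  ((Real.Gamma (1 - s))⁻¹ : ℝ) • deriv (fun y : ℝ => ∫ ξ in a..y, ((y - ξ) ^ (-s) : ℝ) • u ξ) x

/-- Right Riemann–Liouville derivative of order `s ∈ (0, 1)` with base point `b`:
`-1/Γ(1-s) · d/dx ∫_x^b (ξ-x)^{-s} u(ξ) dξ`. -/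
def rightRL (b s : ℝ) (u : ℝ → ℂ) (x : ℝ) : ℂ :=
  (-(Real.Gamma (1 - s))⁻¹ : ℝ) • deriv (fun y : ℝ => ∫ ξ in y..b, ((ξ - y) ^ (-s) : ℝ) • u ξ) x

/-- The form `B(u, v)` of the negative Riesz derivative of order `α` on `(a, b)`:
the sum of the two mixed products of left and right Riemann–Liouville derivatives of order `α/2`,
divided by `2 cos(απ/2)`. -/
def rieszForm (a b α : ℝ) (u v : ℝ → ℂ) : ℂ :=
  (l2Inner a b (leftRL a (α / 2) u) (rightRL b (α / 2) v) +
      l2Inner a b (rightRL b (α / 2) u) (leftRL a (α / 2) v)) /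
    ((2 * Real.cos (α * Real.pi / 2) : ℝ) : ℂ)

/-- The Caputo fractional substantial derivative of order `γ ∈ (0, 1)` of `G(t, x)` in `t`:
`e^{-pU(x)t} · 1/Γ(1-γ) ∫_0^t (t-s)^{-γ} e^{pU(x)s} (∂_s + pU(x)) G(s, x) ds`. -/
def caputoSubstantial (γ : ℝ) (p : ℂ) (U : ℝ → ℝ) (G : ℝ → ℝ → ℂ) (t x : ℝ) : ℂ :=
  Complex.exp (-(p * (U x : ℂ) * (t : ℂ))) *
    (((Real.Gamma (1 - γ))⁻¹ : ℝ) •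
      ∫ s in (0 : ℝ)..t, ((t - s) ^ (-γ) : ℝ) •
        (Complex.exp (p * (U x : ℂ) * (s : ℂ)) *
          (deriv (fun τ : ℝ => G τ x) s + p * (U x : ℂ) * G s x)))

/-! ### B-spline multiresolution spaces -/

/-- Divided difference `[τ_m, …, τ_{m+n}] f` for a nondecreasing sequence of points `τ`;
if all the points coincide it is `f⁽ⁿ⁾(τ_m) / n!`. -/
def dividedDiff (f : ℝ → ℝ) (τ : ℕ → ℝ) : ℕ → ℕ → ℝ
  | 0, m => f (τ m)
  | n + 1, m =>
      if τ (m + n + 1) = τ m then iteratedDeriv (n + 1) f (τ m) / (Nat.factorial (n + 1) : ℝ)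
      else (dividedDiff f τ n (m + 1) - dividedDiff f τ n m) / (τ (m + n + 1) - τ m)

/-- The Schoenberg knots of order `d` and level `j` on `[0, 1]`, numbered from `1`:
`0` (`d` times), `2^{-j}, …, 1 - 2^{-j}`, `1` (`d` times). -/
def knot (d j i : ℕ) : ℝ :=
  max 0 (min 1 (((i : ℝ) - (d : ℝ)) / 2 ^ j))

/-- The scaling function on `[0, 1]`:
`φ_{j,k}(x) = 2^{j/2} (t_{k+d+1} - t_{k+1}) [t_{k+1}, …, t_{k+d+1}] (t - x)_+^{d-1}`. -/
def bspline (d j k : ℕ) (x : ℝ) : ℝ :=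
  (2 : ℝ) ^ ((j : ℝ) / 2) * (knot d j (k + d + 1) - knot d j (k + 1)) *
    dividedDiff (fun t : ℝ => (max 0 (t - x)) ^ (d - 1)) (knot d j) d (k + 1)

/-- The scaling function transported to `Ω = (a, b)` by the affine map, with complex values. -/
def scaling (a b : ℝ) (d j k : ℕ) (x : ℝ) : ℂ :=
  ((bspline d j k ((x - a) / (b - a)) : ℝ) : ℂ)

/-- The index set `{1, …, 2^j + d - 3}` of the scaling functions of order `d` and level `j`. -/
def scalingIndex (d j : ℕ) : Finset ℕ := Finset.Icc 1 (2 ^ j + d - 3)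

/-- The (complex) trial and test space, the span of the scaling functions of level `J`. -/
def splineSpace (a b : ℝ) (d J : ℕ) : Submodule ℂ (ℝ → ℂ) :=
  Submodule.span ℂ ((fun k => scaling a b d J k) '' (scalingIndex d J : Set ℕ))

/-! ### The space semi-discrete scheme -/

/-- `G : [0, T] → S_J` solves the Galerkin space semi-discretization of
`ˢD_{*,t}^γ G = K ∇^α G + f`: its coefficients in the scaling functions are absolutely continuous
on `[0, T]`, and `(ˢD_{*,t}^γ G(t), v) + K B(G(t), v) = (f(t), v)` for all `v ∈ S_J` and almost
every `t ∈ (0, T)`. -/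
structure IsSemiDiscreteSolution (a b α γ K T : ℝ) (d J : ℕ) (p : ℂ) (U : ℝ → ℝ)
    (f : ℝ → ℝ → ℂ) (G : ℝ → ℝ → ℂ) : Prop where
  trial : ∃ c : ℕ → ℝ → ℂ,
    (∀ k ∈ scalingIndex d J, AbsolutelyContinuousOnInterval (c k) 0 T) ∧
    ∀ t ∈ Icc (0 : ℝ) T, ∀ x : ℝ, G t x = ∑ k ∈ scalingIndex d J, c k t * scaling a b d J k x
  weak : ∀ᵐ t ∂(volume.restrict (Ioo (0 : ℝ) T)), ∀ v ∈ splineSpace a b d J,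
    l2Inner a b (caputoSubstantial γ p U G t) v + (K : ℂ) * rieszForm a b α (G t) v =
      l2Inner a b (f t) v

end FeynmanKac

end

namespace FeynmanKac

open Filter Topology

/-! The proof is an energy argument. Since `G s` lies in the spline space, it may be used as its own
test function; taking real parts and integrating over (0,t) gives ∫ Re(D G, G) + ∫ K Re B(G,G) = ∫
Re(f,G). Three facts then finish the proof: a coercive lower bound for the first term, nonnegativity
of the second, and Young's inequality for the third.

Lower bound for the fractional term (`integral_substantialIntegral_ge`). For fixed x put q = pU(x)
and h(s) = e^{qs}G(s,x). The substantial derivative is e^{-qt} times the Caputo derivative of h, so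
its product with the conjugate of G has real part e^{-2 Re(q) t} times the sum of f D f over f = Re
h, Im h. Pointwise f D f ≥ ½ D(f²) (`integral_singular_mul_le`). Integrating ½ D(f²) against the
weight e^{-2rt}, with r = Re q, exchanging the integrals and integrating by parts in s leaves half
of ∫ (τ-s)^{-γ} e^{-2rs} f² minus an initial term (`weighted_integral_deriv_sq_ge`). The key
inequality is `rpow_le_tempered`: what the weight takes away from the kernel is returned by the
derivative of the weight, so no constant depends on r. Since e^{-2rs}|h|² = |G|² and (τ-s)^{-γ} ≥
T^{-γ}, the outcome is A∫‖G‖² - B‖G(0)‖² with A, B depending on γ and T only, hence uniform in x, p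
and U.

Nonnegativity of the form (`rieszForm_re_nonneg`). Spline functions are Lipschitz and vanish at both
ends (`splineSpace_le`), because no knot of an admissible B-spline has multiplicity d. For such u
the two Riemann–Liouville derivatives are, almost everywhere, the left weakly singular integral of
u' and minus the right one. The integral of left times right integral of a real function w is
nonnegative (`integral_left_mul_right_nonneg`): it is a positive multiple of a quadratic form X with
kernel (ξ-η)_+^{1-2s}, and the integral of the square of the right integral is a positive multiple
of 2X. The minus sign is compensated by cos(απ/2) < 0.

The rest is measurability and integrability in (t,x), obtained from the finite expansion of G in the
scaling functions. -/

/-! ### The weakly singular kernel -/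

/-- The weakly singular kernel `u ↦ u^{-s}` on `u > 0`, extended by zero. -/
noncomputable def singularKernel (s u : ℝ) : ℝ := (Ioi (0 : ℝ)).indicator (fun u => u ^ (-s)) u

lemma singularKernel_of_pos {s u : ℝ} (hu : 0 < u) : singularKernel s u = u ^ (-s) := by
  simp [singularKernel, hu]

lemma singularKernel_of_nonpos {s u : ℝ} (hu : u ≤ 0) : singularKernel s u = 0 := by
  simp [singularKernel, hu]

lemma singularKernel_nonneg (s u : ℝ) : 0 ≤ singularKernel s u :=
  indicator_nonneg (fun _ hx => Real.rpow_nonneg (le_of_lt hx) _) _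

@[fun_prop]
lemma measurable_singularKernel (s : ℝ) : Measurable (singularKernel s) :=
  (by fun_prop : Measurable fun u : ℝ => u ^ (-s)).indicator measurableSet_Ioi

lemma integrableOn_singularKernel {s : ℝ} (hs : s < 1) (c d : ℝ) :
    IntegrableOn (singularKernel s) (Ioc c d) := by
  have h : IntegrableOn (fun u : ℝ => u ^ (-s)) (Ioc 0 (max d 0)) :=
    (intervalIntegrable_iff_integrableOn_Ioc_of_le (le_max_right _ _)).1
      (intervalIntegral.intervalIntegrable_rpow' (by linarith))
  have h2 : Integrable ((Ioc 0 (max d 0)).indicator fun u : ℝ => u ^ (-s)) :=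
    h.integrable_indicator measurableSet_Ioc
  refine (h2.integrableOn (s := Ioc c d)).congr_fun (fun u hu => ?_) measurableSet_Ioc
  by_cases hu0 : 0 < u
  · simp [singularKernel, hu0, hu.2]
  · simp [singularKernel, hu0]

/-- The weakly singular integrand is integrable on the square. -/
lemma integrable_singularKernel_smul {E : Type*} [NormedAddCommGroup E] [NormedSpace ℝ E]
    {s : ℝ} (hs : s < 1) {a b : ℝ} {g : ℝ → E} (hg : IntegrableOn g (Ioc a b)) :
    Integrable (fun p : ℝ × ℝ => singularKernel s (p.1 - p.2) • g p.2)
      ((volume.restrict (Ioc a b)).prod (volume.restrict (Ioc a b))) := by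
  have hk : Integrable ((Ioc 0 (b - a)).indicator (singularKernel s)) :=
    (integrableOn_singularKernel hs 0 (b - a)).integrable_indicator measurableSet_Ioc
  -- On the square only kernel arguments in (0, b-a] matter, so the kernel can be truncated to an
  -- integrable function and the integrand becomes that of a convolution of two integrable
  -- functions.
  have h := hg.convolution_integrand (ContinuousLinearMap.lsmul ℝ ℝ).flip hk
  rw [Measure.prod_restrict]
  have h' := h.mono_measure (Measure.prod_mono
    (Measure.restrict_le_self (μ := volume) (s := Ioc a b)) le_rfl)
  rw [Measure.prod_restrict] at h'
  refine h'.congr ?_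
  filter_upwards [ae_restrict_mem (measurableSet_Ioc.prod measurableSet_Ioc)] with p hp
  simp only [ContinuousLinearMap.flip_apply, ContinuousLinearMap.lsmul_apply]
  congr 1
  by_cases h0 : 0 < p.1 - p.2
  · rw [indicator_of_mem]
    exact ⟨h0, by linarith [hp.1.2, hp.2.1]⟩
  · rw [singularKernel_of_nonpos (not_lt.1 h0), indicator_of_notMem]
    exact fun h => h0 h.1

/-- Extending the kernel by zero trades the moving upper limit for a fixed domain, the form in which
Fubini applies. -/
lemma setIntegral_singularKernel_left {E : Type*} [NormedAddCommGroup E] [NormedSpace ℝ E]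
    (s : ℝ) {a b x : ℝ} (hx : x ∈ Icc a b) (g : ℝ → E) :
    ∫ ξ in Ioc a b, singularKernel s (x - ξ) • g ξ = ∫ ξ in a..x, ((x - ξ) ^ (-s) : ℝ) • g ξ := by
  have hI : Ioo a x = Ioc a b ∩ Iio x := by
    ext ξ
    exact ⟨fun h => ⟨⟨h.1, (h.2.trans_le hx.2).le⟩, h.2⟩, fun h => ⟨h.1.1, h.2⟩⟩
  rw [intervalIntegral.integral_of_le hx.1, integral_Ioc_eq_integral_Ioo (x := a) (y := x), hI,
    ← setIntegral_indicator measurableSet_Iio]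
  refine integral_congr_ae (Eventually.of_forall fun ξ => ?_)
  by_cases h : ξ < x
  · simp [h, singularKernel_of_pos]
  · simp [h, singularKernel_of_nonpos (sub_nonpos.2 (not_lt.1 h))]

/-- For a merely integrable density the singular integral is guaranteed to converge only for almost
every x, as a section of the integrable function on the square. -/
lemma ae_intervalIntegrable_singular {E : Type*} [NormedAddCommGroup E] [NormedSpace ℝ E]
    {s : ℝ} (hs : s < 1) {a b : ℝ} {g : ℝ → E} (hg : IntegrableOn g (Ioc a b)) :
    ∀ᵐ x ∂(volume.restrict (Ioc a b)),
      IntervalIntegrable (fun ξ => ((x - ξ) ^ (-s) : ℝ) • g ξ) volume a x := by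
  filter_upwards [(integrable_singularKernel_smul hs hg).prod_right_ae,
    ae_restrict_mem measurableSet_Ioc] with x hx hxm
  rw [intervalIntegrable_iff_integrableOn_Ioo_of_le hxm.1.le]
  have : IntegrableOn (fun ξ => singularKernel s (x - ξ) • g ξ) (Ioo a x) :=
    IntegrableOn.mono_set hx (Ioo_subset_Ioc_self.trans (Ioc_subset_Ioc_right hxm.2))
  exact this.congr_fun (fun ξ hξ => by simp only [singularKernel_of_pos (sub_pos.2 hξ.2)])
    measurableSet_Ioo

/-! ### Complex valued absolutely continuous functions -/

/-- A contraction does not increase the sums in the definition of absolute continuity. Applied to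
real and imaginary parts, it carries the real theory over to complex values. -/
lemma ac_of_dist_le {f : ℝ → ℂ} {g : ℝ → ℝ} {a b : ℝ} (hf : AbsolutelyContinuousOnInterval f a b)
    (h : ∀ x y, dist (g x) (g y) ≤ dist (f x) (f y)) : AbsolutelyContinuousOnInterval g a b :=
  squeeze_zero (fun _ => Finset.sum_nonneg fun _ _ => dist_nonneg)
    (fun _ => Finset.sum_le_sum fun _ _ => h _ _) hf

lemma ac_re {f : ℝ → ℂ} {a b : ℝ} (hf : AbsolutelyContinuousOnInterval f a b) :
    AbsolutelyContinuousOnInterval (fun t => (f t).re) a b :=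
  ac_of_dist_le hf fun x y => by
    rw [Real.dist_eq, Complex.dist_eq, ← Complex.sub_re]; exact Complex.abs_re_le_norm _

lemma ac_im {f : ℝ → ℂ} {a b : ℝ} (hf : AbsolutelyContinuousOnInterval f a b) :
    AbsolutelyContinuousOnInterval (fun t => (f t).im) a b :=
  ac_of_dist_le hf fun x y => by
    rw [Real.dist_eq, Complex.dist_eq, ← Complex.sub_im]; exact Complex.abs_im_le_norm _

lemma hasDerivAt_re {f : ℝ → ℂ} {f' : ℂ} {x : ℝ} (h : HasDerivAt f f' x) :
    HasDerivAt (fun t => (f t).re) f'.re x :=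
  Complex.reCLM.hasFDerivAt.comp_hasDerivAt x h

lemma hasDerivAt_im {f : ℝ → ℂ} {f' : ℂ} {x : ℝ} (h : HasDerivAt f f' x) :
    HasDerivAt (fun t => (f t).im) f'.im x :=
  Complex.imCLM.hasFDerivAt.comp_hasDerivAt x h

lemma hasDerivAt_of_re_im {f : ℝ → ℂ} {u v x : ℝ} (h : HasDerivAt (fun t => (f t).re) u x)
    (h' : HasDerivAt (fun t => (f t).im) v x) : HasDerivAt f (u + v * Complex.I) x := by
  have := h.ofReal_comp.add (h'.ofReal_comp.mul_const Complex.I)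
  exact this.congr_of_eventuallyEq (Eventually.of_forall fun t => (Complex.re_add_im (f t)).symm)

lemma ac_ae_hasDerivAt {f : ℝ → ℂ} {a b : ℝ} (hf : AbsolutelyContinuousOnInterval f a b) :
    ∀ᵐ x : ℝ, x ∈ uIcc a b → HasDerivAt f
      (deriv (fun t => (f t).re) x + deriv (fun t => (f t).im) x * Complex.I) x := by
  filter_upwards [(ac_re hf).ae_differentiableAt, (ac_im hf).ae_differentiableAt] with x h1 h2 hx
  exact hasDerivAt_of_re_im (h1 hx).hasDerivAt (h2 hx).hasDerivAt

lemma ac_ae_differentiableAt {f : ℝ → ℂ} {a b : ℝ} (hf : AbsolutelyContinuousOnInterval f a b) :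
    ∀ᵐ x : ℝ, x ∈ uIcc a b → DifferentiableAt ℝ f x := by
  filter_upwards [ac_ae_hasDerivAt hf] with x h hx using (h hx).differentiableAt

lemma ac_intervalIntegrable_deriv {f : ℝ → ℂ} {a b : ℝ}
    (hf : AbsolutelyContinuousOnInterval f a b) : IntervalIntegrable (deriv f) volume a b := by
  have h1 : IntervalIntegrable (fun x => ((deriv (fun t => (f t).re) x : ℝ) : ℂ)) volume a b :=
    ⟨(ac_re hf).intervalIntegrable_deriv.1.ofReal, (ac_re hf).intervalIntegrable_deriv.2.ofReal⟩
  have h2 : IntervalIntegrable (fun x => ((deriv (fun t => (f t).im) x : ℝ) : ℂ)) volume a b :=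
    ⟨(ac_im hf).intervalIntegrable_deriv.1.ofReal, (ac_im hf).intervalIntegrable_deriv.2.ofReal⟩
  refine (h1.add (h2.mul_const Complex.I)).congr_ae ?_
  rw [EventuallyEq, ae_restrict_iff' measurableSet_uIoc]
  filter_upwards [ac_ae_hasDerivAt hf] with x h hx
  exact (h (uIoc_subset_uIcc hx)).deriv.symm

lemma ac_integral_deriv {f : ℝ → ℂ} {a b : ℝ} (hf : AbsolutelyContinuousOnInterval f a b) :
    ∫ x in a..b, deriv f x = f b - f a := by
  have hd := ac_intervalIntegrable_deriv hf
  have hae := ac_ae_differentiableAt hf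
  have h1 : ∫ x in a..b, (deriv f x).re = (f b - f a).re := by
    rw [Complex.sub_re, ← (ac_re hf).integral_deriv_eq_sub]
    refine intervalIntegral.integral_congr_ae ?_
    filter_upwards [hae] with x h hx
    exact (hasDerivAt_re (h (uIoc_subset_uIcc hx)).hasDerivAt).deriv.symm
  have h2 : ∫ x in a..b, (deriv f x).im = (f b - f a).im := by
    rw [Complex.sub_im, ← (ac_im hf).integral_deriv_eq_sub]
    refine intervalIntegral.integral_congr_ae ?_
    filter_upwards [hae] with x h hx
    exact (hasDerivAt_im (h (uIoc_subset_uIcc hx)).hasDerivAt).deriv.symm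
  apply Complex.ext
  · rw [← h1]; exact (Complex.reCLM.intervalIntegral_comp_comm hd).symm
  · rw [← h2]; exact (Complex.imCLM.intervalIntegral_comp_comm hd).symm

/-! ### Positivity of the Caputo derivative -/

lemma ac_sq_sub_const {f : ℝ → ℝ} {a b : ℝ} (hf : AbsolutelyContinuousOnInterval f a b) (c : ℝ) :
    AbsolutelyContinuousOnInterval (fun s => (f s - c) ^ 2) a b := by
  have h1 : AbsolutelyContinuousOnInterval (fun _ : ℝ => c) a b :=
    (LipschitzWith.const c).lipschitzOnWith.absolutelyContinuousOnInterval
  have h2 := (hf.fun_sub h1).mul (hf.fun_sub h1)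
  convert h2 using 1
  funext s
  simp [sq]

lemma ae_deriv_sq_sub_const {f : ℝ → ℝ} {a b : ℝ} (hf : AbsolutelyContinuousOnInterval f a b)
    (c : ℝ) :
    ∀ᵐ s, s ∈ uIcc a b → deriv (fun s => (f s - c) ^ 2) s = 2 * ((f s - c) * deriv f s) := by
  filter_upwards [hf.ae_differentiableAt] with s h hs
  exact (((h hs).hasDerivAt.sub_const c).fun_pow 2).deriv.trans (by push_cast; ring)

/-- Regularized form of the inequality between `f D^γ f` and `½ D^γ f²`. -/
lemma integral_shifted_kernel_mul_sub_nonpos {γ ε t : ℝ} (hγ : 0 < γ) (hε : 0 < ε) (ht : 0 ≤ t)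
    {f : ℝ → ℝ} (hf : AbsolutelyContinuousOnInterval f 0 t) :
    ∫ s in (0 : ℝ)..t, (t - s + ε) ^ (-γ) * ((f s - f t) * deriv f s) ≤ 0 := by
  have hder : ∀ s ∈ uIcc 0 t, HasDerivAt (fun s : ℝ => (t - s + ε) ^ (-γ))
      (γ * (t - s + ε) ^ (-γ - 1)) s := by
    intro s hs
    rw [uIcc_of_le ht] at hs
    have hpos : 0 < t - s + ε := by linarith [hs.2]
    have h1 : HasDerivAt (fun s : ℝ => t - s + ε) (-1) s :=
      ((hasDerivAt_id s).const_sub t).add_const ε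
    convert h1.rpow_const (p := -γ) (Or.inl hpos.ne') using 1
    ring
  have hk : AbsolutelyContinuousOnInterval (fun s : ℝ => (t - s + ε) ^ (-γ)) 0 t := by
    apply ContDiffOn.absolutelyContinuousOnInterval
    intro s hs
    rw [uIcc_of_le ht] at hs
    have hpos : t - s + ε ≠ 0 := by linarith [hs.2]
    exact (ContDiffAt.rpow_const_of_ne (f := fun s : ℝ => t - s + ε) (n := 1) (by fun_prop)
      hpos).contDiffWithinAt
  -- Subtracting the constant `f t` makes the boundary term at s = t vanish. The remaining boundary
  -- term at 0 and the term with the increasing kernel's derivative both have the favourable sign.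
  have key := hk.integral_mul_deriv_eq_deriv_mul (ac_sq_sub_const hf (f t))
  have e1 : ∫ s in (0 : ℝ)..t, (t - s + ε) ^ (-γ) * deriv (fun s => (f s - f t) ^ 2) s =
      2 * ∫ s in (0 : ℝ)..t, (t - s + ε) ^ (-γ) * ((f s - f t) * deriv f s) := by
    rw [← intervalIntegral.integral_const_mul]
    refine intervalIntegral.integral_congr_ae ?_
    filter_upwards [ae_deriv_sq_sub_const hf (f t)] with s h hs
    rw [h (uIoc_subset_uIcc hs)]; ring
  have e2 : 0 ≤ ∫ s in (0 : ℝ)..t, deriv (fun s : ℝ => (t - s + ε) ^ (-γ)) s * (f s - f t) ^ 2 := by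
    refine intervalIntegral.integral_nonneg ht fun s hs => ?_
    rw [(hder s (by rwa [uIcc_of_le ht])).deriv]
    have hpos : 0 < t - s + ε := by linarith [hs.2]
    positivity
  have e3 : 0 ≤ (t - 0 + ε) ^ (-γ) * (f 0 - f t) ^ 2 := by
    have : 0 < t - 0 + ε := by linarith
    positivity
  rw [e1] at key
  simp only [sub_self, ne_eq, OfNat.ofNat_ne_zero, not_false_eq_true, zero_pow, mul_zero] at key
  linarith

/-- `f D^γ f ≥ ½ D^γ f²` for the Caputo derivative of an absolutely continuous function, wherever
the singular integral converges. -/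
lemma integral_singular_mul_le {γ t : ℝ} (hγ : 0 < γ) (ht : 0 ≤ t)
    {f : ℝ → ℝ} (hf : AbsolutelyContinuousOnInterval f 0 t)
    (hi : IntervalIntegrable (fun s => (t - s) ^ (-γ) * deriv f s) volume 0 t) :
    ∫ s in (0 : ℝ)..t, (t - s) ^ (-γ) * (f s * deriv f s) ≤
      f t * ∫ s in (0 : ℝ)..t, (t - s) ^ (-γ) * deriv f s := by
  obtain ⟨C, hC⟩ := hf.exists_bound
  have hcont := hf.continuousOn
  have hi2 : IntervalIntegrable (fun s => f s * ((t - s) ^ (-γ) * deriv f s)) volume 0 t :=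
    hi.continuousOn_mul hcont
  suffices h : ∫ s in (0 : ℝ)..t, (t - s) ^ (-γ) * ((f s - f t) * deriv f s) ≤ 0 by
    have e : ∫ s in (0 : ℝ)..t, (t - s) ^ (-γ) * ((f s - f t) * deriv f s) =
        (∫ s in (0 : ℝ)..t, f s * ((t - s) ^ (-γ) * deriv f s)) -
          f t * ∫ s in (0 : ℝ)..t, (t - s) ^ (-γ) * deriv f s := by
      rw [← intervalIntegral.integral_const_mul, ← intervalIntegral.integral_sub hi2
        (hi.const_mul _)]
      refine intervalIntegral.integral_congr fun s _ => ?_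
      ring
    have e' : ∫ s in (0 : ℝ)..t, (t - s) ^ (-γ) * (f s * deriv f s) =
        ∫ s in (0 : ℝ)..t, f s * ((t - s) ^ (-γ) * deriv f s) :=
      intervalIntegral.integral_congr fun s _ => by ring
    rw [e']; linarith
  have hmeas : AEStronglyMeasurable (fun s => (f s - f t) * deriv f s)
      (volume.restrict (uIoc 0 t)) :=
    (((hcont.mono uIoc_subset_uIcc).aestronglyMeasurable measurableSet_uIoc).sub
      aestronglyMeasurable_const).mul
      (measurable_deriv f).aestronglyMeasurable
  have lim : Tendsto (fun ε : ℝ => ∫ s in (0 : ℝ)..t, (t - s + ε) ^ (-γ) *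
      ((f s - f t) * deriv f s)) (𝓝[>] 0)
      (𝓝 (∫ s in (0 : ℝ)..t, (t - s) ^ (-γ) * ((f s - f t) * deriv f s))) := by
    -- The shifted kernel lies below the singular one and |f s - f t| ≤ 2C, so the assumed
    -- convergence of the singular integral supplies the majorant.
    refine intervalIntegral.tendsto_integral_filter_of_dominated_convergence
      (fun s => 2 * C * ‖(t - s) ^ (-γ) * deriv f s‖) ?_ ?_ (hi.norm.const_mul _) ?_
    · refine Eventually.of_forall fun ε => ?_
      exact (by fun_prop : Measurable fun s : ℝ => (t - s + ε) ^ (-γ)).aestronglyMeasurable.mul hmeas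
    · filter_upwards [self_mem_nhdsWithin] with ε hε
      have hne : ∀ᵐ s : ℝ, s ≠ t := by simp [ae_iff, measure_singleton]
      filter_upwards [hne] with s hst hs
      have hs' := hs
      rw [uIoc_of_le ht] at hs'
      have hpos : 0 < t - s := by
        have := lt_of_le_of_ne hs'.2 hst; linarith
      have hε : (0 : ℝ) < ε := hε
      have h1 : (t - s + ε) ^ (-γ) ≤ (t - s) ^ (-γ) :=
        Real.rpow_le_rpow_of_nonpos hpos (by linarith) (by linarith)
      have h2 : |f s - f t| ≤ 2 * C := by
        have a1 := hC s (uIoc_subset_uIcc hs)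
        have a2 := hC t right_mem_uIcc
        rw [Real.norm_eq_abs] at a1 a2
        have := abs_sub (f s) (f t)
        linarith
      have h3 : 0 ≤ (t - s + ε) ^ (-γ) := by positivity
      rw [norm_mul, norm_mul, norm_mul, Real.norm_eq_abs, Real.norm_eq_abs, Real.norm_eq_abs,
        abs_of_nonneg h3, Real.norm_eq_abs, abs_of_nonneg (h3.trans h1)]
      calc (t - s + ε) ^ (-γ) * (|f s - f t| * |deriv f s|)
          ≤ (t - s) ^ (-γ) * (2 * C * |deriv f s|) := by gcongr
        _ = _ := by ring
    · have hne : ∀ᵐ s : ℝ, s ≠ t := by simp [ae_iff, measure_singleton]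
      filter_upwards [hne] with s hst hs
      refine Tendsto.mul_const _ ?_
      have hc : ContinuousAt (fun ε : ℝ => (t - s + ε) ^ (-γ)) 0 :=
        ContinuousAt.rpow_const (by fun_prop) (Or.inl (by
          simpa [sub_eq_zero] using fun h : t = s => hst h.symm))
      simpa [ContinuousAt] using hc.tendsto.mono_left nhdsWithin_le_nhds
  refine le_of_tendsto lim ?_
  filter_upwards [self_mem_nhdsWithin] with ε hε
  exact integral_shifted_kernel_mul_sub_nonpos hγ hε ht hf

/-- The primitive `∫_0^u e^{-2rv} v^{-γ} dv` of the tempered kernel. -/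
noncomputable def temperedPrimitive (γ r u : ℝ) : ℝ :=
  ∫ v in (0 : ℝ)..u, Real.exp (-(2 * r * v)) * v ^ (-γ)

lemma intervalIntegrable_tempered {γ : ℝ} (hγ1 : γ < 1) (r c d : ℝ) :
    IntervalIntegrable (fun v : ℝ => Real.exp (-(2 * r * v)) * v ^ (-γ)) volume c d :=
  (intervalIntegral.intervalIntegrable_rpow' (by linarith)).continuousOn_mul (by fun_prop)

lemma temperedPrimitive_le {γ r u : ℝ} (hγ1 : γ < 1) (hr : 0 ≤ r) (hu : 0 ≤ u) :
    temperedPrimitive γ r u ≤ u ^ (1 - γ) / (1 - γ) := by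
  have h : ∫ v in (0 : ℝ)..u, v ^ (-γ) = u ^ (1 - γ) / (1 - γ) := by
    rw [integral_rpow (Or.inl (by linarith)), Real.zero_rpow (by linarith)]
    ring_nf
  rw [← h]
  refine intervalIntegral.integral_mono_on hu (intervalIntegrable_tempered hγ1 r 0 u)
    (intervalIntegral.intervalIntegrable_rpow' (by linarith)) fun v hv => ?_
  have h1 : Real.exp (-(2 * r * v)) ≤ 1 := Real.exp_le_one_iff.2 (by
    have := mul_nonneg hr hv.1; linarith)
  exact mul_le_of_le_one_left (Real.rpow_nonneg hv.1 _) h1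

/-- Write u^{-γ}(1 - e^{-2ru}) as the integral of u^{-γ}·2r e^{-2rv} over 0 < v < u and replace
u^{-γ} by the larger v^{-γ}. This is what makes the estimate uniform in r. -/
lemma rpow_le_tempered {γ r u : ℝ} (hγ : 0 < γ) (hγ1 : γ < 1) (hr : 0 ≤ r) (hu : 0 < u) :
    u ^ (-γ) ≤ 2 * r * temperedPrimitive γ r u + Real.exp (-(2 * r * u)) * u ^ (-γ) := by
  have h1 : ∫ v in (0 : ℝ)..u, u ^ (-γ) * (2 * r * Real.exp (-(2 * r * v))) =
      u ^ (-γ) * (1 - Real.exp (-(2 * r * u))) := by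
    rw [intervalIntegral.integral_const_mul]
    congr 1
    have hd : ∀ v ∈ uIcc 0 u, HasDerivAt (fun v : ℝ => -Real.exp (-(2 * r * v)))
        (2 * r * Real.exp (-(2 * r * v))) v := by
      intro v _
      have h0 : HasDerivAt (fun v : ℝ => -(2 * r * v)) (-(2 * r * 1)) v :=
        ((hasDerivAt_id v).const_mul (2 * r)).neg
      exact h0.exp.neg.congr_deriv (by ring)
    rw [intervalIntegral.integral_eq_sub_of_hasDerivAt hd
      (Continuous.intervalIntegrable (by fun_prop) _ _)]
    simp; ring
  have h2 : ∫ v in (0 : ℝ)..u, u ^ (-γ) * (2 * r * Real.exp (-(2 * r * v))) ≤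
      2 * r * temperedPrimitive γ r u := by
    rw [temperedPrimitive, ← intervalIntegral.integral_const_mul]
    refine intervalIntegral.integral_mono_on_of_le_Ioo hu.le
      (Continuous.intervalIntegrable (by fun_prop) _ _)
      ((intervalIntegrable_tempered hγ1 r 0 u).const_mul _) fun v hv => ?_
    have : u ^ (-γ) ≤ v ^ (-γ) := Real.rpow_le_rpow_of_nonpos hv.1 hv.2.le (by linarith)
    calc u ^ (-γ) * (2 * r * Real.exp (-(2 * r * v)))
        ≤ v ^ (-γ) * (2 * r * Real.exp (-(2 * r * v))) := by gcongr
      _ = _ := by ring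
  rw [h1] at h2
  linarith

/-- The inner integral after exchanging the order of integration; the substitution t = s + v splits
the weight into e^{-2rs} and e^{-2rv}. -/
lemma integral_exp_singularKernel {γ r τ s : ℝ} (hs : s ∈ Ioc 0 τ) :
    ∫ t in Ioc 0 τ, Real.exp (-(2 * r * t)) * singularKernel γ (t - s) =
      Real.exp (-(2 * r * s)) * temperedPrimitive γ r (τ - s) := by
  have hI : Ioc s τ = Ioc 0 τ ∩ Ioi s := by
    ext t
    exact ⟨fun h => ⟨⟨hs.1.trans h.1, h.2⟩, h.1⟩, fun h => ⟨h.2, h.1.2⟩⟩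
  have h1 : ∫ t in Ioc 0 τ, Real.exp (-(2 * r * t)) * singularKernel γ (t - s) =
      ∫ t in s..τ, Real.exp (-(2 * r * s)) *
        (Real.exp (-(2 * r * (t - s))) * (t - s) ^ (-γ)) := by
    rw [intervalIntegral.integral_of_le hs.2, hI, ← setIntegral_indicator measurableSet_Ioi]
    refine integral_congr_ae (Eventually.of_forall fun t => ?_)
    by_cases h : s < t
    · simp only [mem_Ioi, h, indicator_of_mem, singularKernel_of_pos (sub_pos.2 h)]
      rw [← mul_assoc, ← Real.exp_add]
      ring_nf
    · simp [h, singularKernel_of_nonpos (sub_nonpos.2 (not_lt.1 h))]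
  rw [h1, intervalIntegral.integral_const_mul, temperedPrimitive,
    intervalIntegral.integral_comp_sub_right
      (fun v => Real.exp (-(2 * r * v)) * v ^ (-γ)) s, sub_self]

/-- As an integral with moving endpoint s, the function becomes visibly absolutely continuous, with
a derivative known almost everywhere. -/
lemma temperedPrimitive_sub_eq (γ r τ s : ℝ) :
    temperedPrimitive γ r (τ - s) =
      -∫ w in τ..s, Real.exp (-(2 * r * (τ - w))) * (τ - w) ^ (-γ) := by
  rw [intervalIntegral.integral_comp_sub_left
    (fun v => Real.exp (-(2 * r * v)) * v ^ (-γ)) τ, sub_self, temperedPrimitive,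
    intervalIntegral.integral_symm]

lemma intervalIntegrable_tempered_sub {γ : ℝ} (hγ1 : γ < 1) (r τ : ℝ) :
    IntervalIntegrable (fun w => Real.exp (-(2 * r * (τ - w))) * (τ - w) ^ (-γ)) volume 0 τ := by
  simpa using (intervalIntegrable_tempered hγ1 r τ 0).comp_sub_left τ

/-- A weighted integral of the Caputo derivative of `f²` is bounded below by the fractional
integral of `f²`, up to the initial value. -/
lemma weighted_integral_deriv_sq_ge {γ r τ : ℝ} (hγ : 0 < γ) (hγ1 : γ < 1) (hr : 0 ≤ r)
    (hτ : 0 ≤ τ) {f : ℝ → ℝ} (hf : AbsolutelyContinuousOnInterval f 0 τ) :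
    ((∫ s in (0 : ℝ)..τ, (τ - s) ^ (-γ) * (Real.exp (-(2 * r * s)) * f s ^ 2)) -
        τ ^ (1 - γ) / (1 - γ) * f 0 ^ 2) / 2 ≤
      ∫ s in (0 : ℝ)..τ, (Real.exp (-(2 * r * s)) * temperedPrimitive γ r (τ - s)) *
        (f s * deriv f s) := by
  have hmi := intervalIntegrable_tempered_sub hγ1 r τ
  have hP : AbsolutelyContinuousOnInterval (fun s => temperedPrimitive γ r (τ - s)) 0 τ := by
    have := (hmi.absolutelyContinuousOnInterval_intervalIntegral right_mem_uIcc).fun_neg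
    rwa [funext fun s => temperedPrimitive_sub_eq γ r τ s]
  have hE : AbsolutelyContinuousOnInterval (fun s : ℝ => Real.exp (-(2 * r * s))) 0 τ :=
    ContDiffOn.absolutelyContinuousOnInterval (by fun_prop)
  have hK := hE.mul hP
  set K : ℝ → ℝ := (fun s : ℝ => Real.exp (-(2 * r * s))) *
    (fun s => temperedPrimitive γ r (τ - s)) with hKdef
  have hf2 := ac_sq_sub_const hf 0
  have key := hK.integral_mul_deriv_eq_deriv_mul hf2
  have e1 : ∫ s in (0 : ℝ)..τ, K s * deriv (fun s => (f s - 0) ^ 2) s =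
      2 * ∫ s in (0 : ℝ)..τ, (Real.exp (-(2 * r * s)) * temperedPrimitive γ r (τ - s)) *
        (f s * deriv f s) := by
    rw [← intervalIntegral.integral_const_mul]
    refine intervalIntegral.integral_congr_ae ?_
    filter_upwards [ae_deriv_sq_sub_const hf 0] with s h hs
    rw [h (uIoc_subset_uIcc hs)]
    simp only [hKdef, Pi.mul_apply, sub_zero]
    ring
  have hw : IntervalIntegrable (fun s => (τ - s) ^ (-γ) * (Real.exp (-(2 * r * s)) * f s ^ 2))
      volume 0 τ := by
    have h0 : IntervalIntegrable (fun w : ℝ => (τ - w) ^ (-γ)) volume 0 τ := by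
      simpa using (intervalIntegral.intervalIntegrable_rpow' (a := τ) (b := 0)
        (r := -γ) (by linarith)).comp_sub_left τ
    refine h0.mul_continuousOn (ContinuousOn.mul (by fun_prop) (hf.continuousOn.pow 2))
  -- Differentiating `K` produces two negative terms, one from the exponential and one from the
  -- primitive; by `rpow_le_tempered` at u = τ - s together they dominate the untempered kernel.
  have e2 : ∫ s in (0 : ℝ)..τ, (τ - s) ^ (-γ) * (Real.exp (-(2 * r * s)) * f s ^ 2) ≤
      ∫ s in (0 : ℝ)..τ, -(deriv K s * (f s - 0) ^ 2) := by
    refine intervalIntegral.integral_mono_ae_restrict hτ hw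
      (hK.intervalIntegrable_deriv.mul_continuousOn hf2.continuousOn).neg ?_
    rw [EventuallyLE, ae_restrict_iff' measurableSet_Icc]
    have hne : ∀ᵐ s : ℝ, s ≠ τ := by simp [ae_iff, measure_singleton]
    filter_upwards [hmi.ae_hasDerivAt_integral, hne] with s h1 hs hsI
    have hP' : HasDerivAt (fun s => temperedPrimitive γ r (τ - s))
        (-(Real.exp (-(2 * r * (τ - s))) * (τ - s) ^ (-γ))) s := by
      rw [funext fun s => temperedPrimitive_sub_eq γ r τ s]
      exact (h1 (by rwa [uIcc_of_le hτ]) τ right_mem_uIcc).neg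
    have hE' : HasDerivAt (fun s : ℝ => Real.exp (-(2 * r * s)))
        (Real.exp (-(2 * r * s)) * (-(2 * r * 1))) s :=
      ((hasDerivAt_id s).const_mul (2 * r)).neg.exp
    rw [(hE'.mul hP').deriv, sub_zero]
    have hpos : 0 < τ - s := sub_pos.2 (lt_of_le_of_ne hsI.2 hs)
    have h2 := rpow_le_tempered hγ hγ1 hr hpos
    have h3 : 0 ≤ Real.exp (-(2 * r * s)) * f s ^ 2 := by positivity
    calc (τ - s) ^ (-γ) * (Real.exp (-(2 * r * s)) * f s ^ 2)
        ≤ (2 * r * temperedPrimitive γ r (τ - s) +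
          Real.exp (-(2 * r * (τ - s))) * (τ - s) ^ (-γ)) *
            (Real.exp (-(2 * r * s)) * f s ^ 2) := mul_le_mul_of_nonneg_right h2 h3
      _ = _ := by ring
  rw [e1] at key
  have e3 : K τ = 0 := by simp [hKdef, temperedPrimitive]
  have e4 : K 0 ≤ τ ^ (1 - γ) / (1 - γ) := by
    simpa [hKdef] using temperedPrimitive_le hγ1 hr hτ
  rw [intervalIntegral.integral_neg] at e2
  rw [e3] at key
  have e5 : K 0 * (f 0 - 0) ^ 2 ≤ τ ^ (1 - γ) / (1 - γ) * f 0 ^ 2 := by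
    rw [sub_zero]; gcongr
  linarith

lemma norm_exp_weight_le_one {r t : ℝ} (hr : 0 ≤ r) (ht : 0 ≤ t) :
    ‖Real.exp (-(2 * r * t))‖ ≤ 1 := by
  rw [Real.norm_eq_abs, Real.abs_exp]
  exact Real.exp_le_one_iff.2 (by have := mul_nonneg hr ht; linarith)

lemma integrable_weighted_caputo {γ r τ : ℝ} (hγ1 : γ < 1) (hr : 0 ≤ r)
    (hτ : 0 ≤ τ) {f : ℝ → ℝ} (hf : AbsolutelyContinuousOnInterval f 0 τ) :
    Integrable (fun t => Real.exp (-(2 * r * t)) *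
        (f t * ∫ s in (0 : ℝ)..t, (t - s) ^ (-γ) * deriv f s)) (volume.restrict (Ioc 0 τ)) := by
  have hfc : ContinuousOn f (Icc 0 τ) := by simpa [uIcc_of_le hτ] using hf.continuousOn
  have hf' : IntegrableOn (deriv f) (Ioc 0 τ) :=
    (intervalIntegrable_iff_integrableOn_Ioc_of_le hτ).1 hf.intervalIntegrable_deriv
  obtain ⟨C, hC⟩ := hf.exists_bound
  have h3 := (integrable_singularKernel_smul hγ1 hf').integral_prod_left
  have h4 : Integrable (fun t => Real.exp (-(2 * r * t)) *
      (f t * ∫ s in Ioc 0 τ, singularKernel γ (t - s) • deriv f s))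
      (volume.restrict (Ioc 0 τ)) := by
    refine Integrable.bdd_mul (c := 1) (Integrable.bdd_mul (c := C) h3
      ((hfc.mono Ioc_subset_Icc_self).aestronglyMeasurable measurableSet_Ioc) ?_)
      (by fun_prop : Continuous _).aestronglyMeasurable ?_
    · filter_upwards [ae_restrict_mem measurableSet_Ioc] with t ht
      exact hC t (by rw [uIcc_of_le hτ]; exact Ioc_subset_Icc_self ht)
    · filter_upwards [ae_restrict_mem measurableSet_Ioc] with t ht
      exact norm_exp_weight_le_one hr ht.1.le
  refine h4.congr ?_
  filter_upwards [ae_restrict_mem measurableSet_Ioc] with t ht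
  rw [setIntegral_singularKernel_left γ ⟨ht.1.le, ht.2⟩]
  rfl

/-- Weighted positivity of `f D^γ f`, up to the initial value, for real functions. -/
lemma weighted_integral_caputo_ge {γ r τ : ℝ} (hγ : 0 < γ) (hγ1 : γ < 1) (hr : 0 ≤ r)
    (hτ : 0 ≤ τ) {f : ℝ → ℝ} (hf : AbsolutelyContinuousOnInterval f 0 τ) :
    ((∫ s in (0 : ℝ)..τ, (τ - s) ^ (-γ) * (Real.exp (-(2 * r * s)) * f s ^ 2)) -
        τ ^ (1 - γ) / (1 - γ) * f 0 ^ 2) / 2 ≤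
      ∫ t in Ioc 0 τ, Real.exp (-(2 * r * t)) *
        (f t * ∫ s in (0 : ℝ)..t, (t - s) ^ (-γ) * deriv f s) := by
  refine (weighted_integral_deriv_sq_ge hγ hγ1 hr hτ hf).trans ?_
  have hf' : IntegrableOn (deriv f) (Ioc 0 τ) :=
    (intervalIntegrable_iff_integrableOn_Ioc_of_le hτ).1 hf.intervalIntegrable_deriv
  have hff' : IntegrableOn (fun s => f s * deriv f s) (Ioc 0 τ) :=
    (intervalIntegrable_iff_integrableOn_Ioc_of_le hτ).1
      (hf.intervalIntegrable_deriv.continuousOn_mul hf.continuousOn)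
  have hker : ∀ g : ℝ → ℝ, ∀ t ∈ Ioc 0 τ, ∫ s in Ioc 0 τ, singularKernel γ (t - s) • g s =
      ∫ s in (0 : ℝ)..t, (t - s) ^ (-γ) * g s := fun g t ht =>
    setIntegral_singularKernel_left γ ⟨ht.1.le, ht.2⟩ g
  have h2 : Integrable (fun p : ℝ × ℝ => Real.exp (-(2 * r * p.1)) *
      (singularKernel γ (p.1 - p.2) • (f p.2 * deriv f p.2)))
      ((volume.restrict (Ioc 0 τ)).prod (volume.restrict (Ioc 0 τ))) := by
    refine (integrable_singularKernel_smul hγ1 hff').bdd_mul (c := 1)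
      (by fun_prop : Continuous _).aestronglyMeasurable ?_
    rw [Measure.prod_restrict]
    filter_upwards [ae_restrict_mem (measurableSet_Ioc.prod measurableSet_Ioc)] with p hp
    exact norm_exp_weight_le_one hr hp.1.1.le
  -- Fubini turns the weighted time integral of the Caputo-type integral of f f' into a single
  -- integral against the primitive of the tempered kernel.
  have hswap : ∫ s in (0 : ℝ)..τ, (Real.exp (-(2 * r * s)) * temperedPrimitive γ r (τ - s)) *
        (f s * deriv f s) = ∫ t in Ioc 0 τ, ∫ s in Ioc 0 τ, Real.exp (-(2 * r * t)) *
      (singularKernel γ (t - s) • (f s * deriv f s)) := by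
    rw [integral_integral_swap h2, intervalIntegral.integral_of_le hτ]
    refine setIntegral_congr_fun measurableSet_Ioc fun s hs => ?_
    rw [← integral_exp_singularKernel hs, ← integral_mul_const]
    refine integral_congr_ae (Eventually.of_forall fun t => ?_)
    simp only [smul_eq_mul]; ring
  rw [hswap]
  refine integral_mono_ae h2.integral_prod_left ?_ ?_
  · exact integrable_weighted_caputo hγ1 hr hτ hf
  · filter_upwards [ae_restrict_mem measurableSet_Ioc,
      ae_intervalIntegrable_singular hγ1 hf'] with t ht hi
    rw [integral_const_mul, hker (fun s => f s * deriv f s) t ht]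
    refine mul_le_mul_of_nonneg_left ?_ (Real.exp_nonneg _)
    exact integral_singular_mul_le hγ ht.1.le
      (hf.mono (by rw [uIcc_of_le hτ, uIcc_of_le ht.1.le]; exact Icc_subset_Icc_right ht.2)) hi

/-! ### Reduction of the substantial derivative to the Caputo derivative -/

lemma ac_exp_mul (q : ℂ) {y : ℝ → ℂ} {a b : ℝ} (hy : AbsolutelyContinuousOnInterval y a b) :
    AbsolutelyContinuousOnInterval (fun s : ℝ => Complex.exp (q * s) * y s) a b := by
  have hE : AbsolutelyContinuousOnInterval (fun s : ℝ => Complex.exp (q * s)) a b := by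
    apply ContDiffOn.absolutelyContinuousOnInterval
    have : ContDiff ℝ 1 (fun s : ℝ => Complex.exp (q * s)) :=
      (contDiff_const.mul Complex.ofRealCLM.contDiff).cexp
    exact this.contDiffOn
  exact hE.fun_smul hy

lemma hasDerivAt_exp_mul (q : ℂ) {y : ℝ → ℂ} {y' : ℂ} {s : ℝ} (hy : HasDerivAt y y' s) :
    HasDerivAt (fun s : ℝ => Complex.exp (q * s) * y s)
      (Complex.exp (q * s) * (y' + q * y s)) s := by
  have h1 : HasDerivAt (fun s : ℝ => Complex.exp (q * s)) (Complex.exp (q * s) * (q * 1)) s :=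
    ((Complex.ofRealCLM.hasDerivAt (x := s)).const_mul q).cexp
  exact (h1.mul hy).congr_deriv (by ring)

/-- The substantial Caputo derivative in time of a function of time only, up to `1/Γ(1-γ)`. -/
noncomputable def substantialIntegral (γ : ℝ) (q : ℂ) (y : ℝ → ℂ) (t : ℝ) : ℂ :=
  Complex.exp (-(q * t)) * ∫ s in (0 : ℝ)..t, ((t - s) ^ (-γ) : ℝ) •
        (Complex.exp (q * s) * (deriv y s + q * y s))

/-- Conjugating by e^{qs} absorbs the zeroth-order term. Since y = e^{-qt}h, multiplying by the
conjugate of y leaves the modulus e^{-2 Re(q) t}, and the imaginary part of q disappears. The real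
part of Z times the conjugate of h splits into two real products. -/
lemma substantialIntegral_re_ae {γ τ : ℝ} (hγ1 : γ < 1) (hτ : 0 ≤ τ)
    (q : ℂ) {y : ℝ → ℂ} (hy : AbsolutelyContinuousOnInterval y 0 τ) :
    ∀ᵐ t ∂(volume.restrict (Ioc 0 τ)),
      (substantialIntegral γ q y t * (starRingEnd ℂ) (y t)).re =
        Real.exp (-(2 * q.re * t)) * ((Complex.exp (q * t) * y t).re *
          ∫ s in (0 : ℝ)..t, (t - s) ^ (-γ) *
            deriv (fun s : ℝ => (Complex.exp (q * s) * y s).re) s) +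
        Real.exp (-(2 * q.re * t)) * ((Complex.exp (q * t) * y t).im *
          ∫ s in (0 : ℝ)..t, (t - s) ^ (-γ) *
            deriv (fun s : ℝ => (Complex.exp (q * s) * y s).im) s) := by
  have hH := ac_exp_mul q hy
  have hH' : IntegrableOn (deriv fun s : ℝ => Complex.exp (q * s) * y s) (Ioc 0 τ) :=
    (intervalIntegrable_iff_integrableOn_Ioc_of_le hτ).1 (ac_intervalIntegrable_deriv hH)
  filter_upwards [ae_restrict_mem measurableSet_Ioc,
    ae_intervalIntegrable_singular hγ1 hH'] with t ht hi
  have hsub : uIoc 0 t ⊆ uIcc 0 τ := by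
    rw [uIoc_of_le ht.1.le, uIcc_of_le hτ]
    exact fun s hs => ⟨hs.1.le, hs.2.trans ht.2⟩
  have hI : ∫ s in (0 : ℝ)..t, ((t - s) ^ (-γ) : ℝ) •
        (Complex.exp (q * s) * (deriv y s + q * y s)) =
      ∫ s in (0 : ℝ)..t, ((t - s) ^ (-γ) : ℝ) •
        deriv (fun s : ℝ => Complex.exp (q * s) * y s) s := by
    refine intervalIntegral.integral_congr_ae ?_
    filter_upwards [ac_ae_differentiableAt hy] with s h hs
    rw [(hasDerivAt_exp_mul q (h (hsub hs)).hasDerivAt).deriv]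
  have hre : (∫ s in (0 : ℝ)..t, ((t - s) ^ (-γ) : ℝ) •
        deriv (fun s : ℝ => Complex.exp (q * s) * y s) s).re = ∫ s in (0 : ℝ)..t, (t - s) ^ (-γ) *
            deriv (fun s : ℝ => (Complex.exp (q * s) * y s).re) s := by
    refine (Complex.reCLM.intervalIntegral_comp_comm hi).symm.trans ?_
    refine intervalIntegral.integral_congr_ae ?_
    filter_upwards [ac_ae_differentiableAt hH] with s h hs
    rw [(hasDerivAt_re (h (hsub hs)).hasDerivAt).deriv]
    simp
  have him : (∫ s in (0 : ℝ)..t, ((t - s) ^ (-γ) : ℝ) •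
        deriv (fun s : ℝ => Complex.exp (q * s) * y s) s).im = ∫ s in (0 : ℝ)..t, (t - s) ^ (-γ) *
            deriv (fun s : ℝ => (Complex.exp (q * s) * y s).im) s := by
    refine (Complex.imCLM.intervalIntegral_comp_comm hi).symm.trans ?_
    refine intervalIntegral.integral_congr_ae ?_
    filter_upwards [ac_ae_differentiableAt hH] with s h hs
    rw [(hasDerivAt_im (h (hsub hs)).hasDerivAt).deriv]
    simp
  rw [substantialIntegral, hI, ← hre, ← him]
  set Z := ∫ s in (0 : ℝ)..t, ((t - s) ^ (-γ) : ℝ) •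
        deriv (fun s : ℝ => Complex.exp (q * s) * y s) s
  have hyt : y t = Complex.exp (-(q * t)) * (Complex.exp (q * t) * y t) := by
    rw [← mul_assoc, ← Complex.exp_add]; simp
  set h := Complex.exp (q * t) * y t
  have hn : Complex.exp (-(q * t)) * (starRingEnd ℂ) (Complex.exp (-(q * t))) =
      ((Real.exp (-(2 * q.re * t)) : ℝ) : ℂ) := by
    rw [← Complex.exp_conj, ← Complex.exp_add, Complex.ofReal_exp]
    congr 1
    apply Complex.ext <;> simp
    ring
  have : Complex.exp (-(q * t)) * Z * (starRingEnd ℂ) (y t) =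
      ((Real.exp (-(2 * q.re * t)) : ℝ) : ℂ) * (Z * (starRingEnd ℂ) h) := by
    rw [← hn]
    conv_lhs => rw [hyt, map_mul]
    ring
  rw [this, Complex.re_ofReal_mul]
  simp only [Complex.mul_re, Complex.conj_re, Complex.conj_im]
  ring

/-- Positivity of the substantial Caputo derivative, up to the initial value. -/
lemma integral_substantialIntegral_ge {γ τ T : ℝ} (hγ : 0 < γ) (hγ1 : γ < 1) (hτ : 0 ≤ τ)
    (hτT : τ ≤ T) {q : ℂ} (hq : 0 ≤ q.re) {y : ℝ → ℂ}
    (hy : AbsolutelyContinuousOnInterval y 0 τ) :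
    (T ^ (-γ) * (∫ s in Ioc 0 τ, ‖y s‖ ^ 2) - T ^ (1 - γ) / (1 - γ) * ‖y 0‖ ^ 2) / 2 ≤
      ∫ t in Ioc 0 τ, (substantialIntegral γ q y t * (starRingEnd ℂ) (y t)).re := by
  have hH := ac_exp_mul q hy
  rw [integral_congr_ae (substantialIntegral_re_ae hγ1 hτ q hy), integral_add
    (integrable_weighted_caputo hγ1 hq hτ (ac_re hH))
    (integrable_weighted_caputo hγ1 hq hτ (ac_im hH))]
  have h1 := weighted_integral_caputo_ge hγ hγ1 hq hτ (ac_re hH)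
  have h2 := weighted_integral_caputo_ge hγ hγ1 hq hτ (ac_im hH)
  have hk : IntervalIntegrable (fun w : ℝ => (τ - w) ^ (-γ)) volume 0 τ := by
    simpa using (intervalIntegral.intervalIntegrable_rpow' (a := τ) (b := 0)
      (r := -γ) (by linarith)).comp_sub_left τ
  have hi : ∀ g : ℝ → ℝ, ContinuousOn g (uIcc 0 τ) → IntervalIntegrable
      (fun s => (τ - s) ^ (-γ) * (Real.exp (-(2 * q.re * s)) * g s ^ 2)) volume 0 τ := fun g hg =>
    hk.mul_continuousOn (ContinuousOn.mul (by fun_prop) (hg.pow 2))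
  have hnorm : ∀ s : ℝ, Real.exp (-(2 * q.re * s)) * (Complex.exp (q * s) * y s).re ^ 2 +
      Real.exp (-(2 * q.re * s)) * (Complex.exp (q * s) * y s).im ^ 2 = ‖y s‖ ^ 2 := by
    intro s
    rw [← mul_add, Complex.sq_norm, ← mul_one (Complex.normSq (y s))]
    have e : (Complex.exp (q * s) * y s).re ^ 2 + (Complex.exp (q * s) * y s).im ^ 2 =
        Real.exp (2 * q.re * s) * Complex.normSq (y s) := by
      have e1 : ∀ z : ℂ, z.re ^ 2 + z.im ^ 2 = Complex.normSq z := fun z => by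
        rw [Complex.normSq_apply]; ring
      rw [e1, Complex.normSq_mul, ← Complex.sq_norm (Complex.exp _), Complex.norm_exp,
        ← Real.exp_nat_mul]
      congr 2
      simp; ring
    rw [e, ← mul_assoc, ← Real.exp_add]
    simp
  have h3 : T ^ (-γ) * (∫ s in Ioc 0 τ, ‖y s‖ ^ 2) ≤
      (∫ s in (0 : ℝ)..τ, (τ - s) ^ (-γ) * (Real.exp (-(2 * q.re * s)) *
        (Complex.exp (q * s) * y s).re ^ 2)) +
      ∫ s in (0 : ℝ)..τ, (τ - s) ^ (-γ) * (Real.exp (-(2 * q.re * s)) *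
        (Complex.exp (q * s) * y s).im ^ 2) := by
    rw [← intervalIntegral.integral_add (hi _ (ac_re hH).continuousOn)
      (hi _ (ac_im hH).continuousOn), ← intervalIntegral.integral_of_le hτ,
      ← intervalIntegral.integral_const_mul]
    refine intervalIntegral.integral_mono_on_of_le_Ioo hτ
      ((hy.continuousOn.norm.pow 2).intervalIntegrable.const_mul _)
      ((hi _ (ac_re hH).continuousOn).add (hi _ (ac_im hH).continuousOn)) fun s hs => ?_
    rw [← mul_add, hnorm]
    -- The lag τ - s never exceeds T, so the kernel is bounded below and controls the plain L² norm.
    have : T ^ (-γ) ≤ (τ - s) ^ (-γ) :=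
      Real.rpow_le_rpow_of_nonpos (by linarith [hs.2]) (by linarith [hs.1]) (by linarith)
    gcongr
  have h4 : τ ^ (1 - γ) / (1 - γ) * (Complex.exp (q * (0 : ℝ)) * y 0).re ^ 2 +
      τ ^ (1 - γ) / (1 - γ) * (Complex.exp (q * (0 : ℝ)) * y 0).im ^ 2 ≤
      T ^ (1 - γ) / (1 - γ) * ‖y 0‖ ^ 2 := by
    have e := hnorm 0
    simp only [mul_zero, neg_zero, Real.exp_zero, one_mul] at e
    rw [← mul_add, e]
    have : τ ^ (1 - γ) ≤ T ^ (1 - γ) := Real.rpow_le_rpow hτ hτT (by linarith)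
    have : 0 < 1 - γ := by linarith
    gcongr
  linarith

/-! ### Divided differences -/

/-- A divided difference is a linear combination of the values and of those derivatives whose order
is below the multiplicity of the point. -/
lemma dividedDiff_mem {X : Type*} (W : Submodule ℝ (X → ℝ)) (F : X → ℝ → ℝ) (τ : ℕ → ℝ) (n m : ℕ)
    (h : ∀ l i, m ≤ l → l + i ≤ m + n → (i = 0 ∨ τ (l + i) = τ l) →
      (fun x => iteratedDeriv i (F x) (τ l)) ∈ W) :
    (fun x => dividedDiff (F x) τ n m) ∈ W := by
  induction n generalizing m with
  | zero => simpa [dividedDiff] using h m 0 le_rfl le_rfl (Or.inl rfl)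
  | succ n ih =>
    by_cases hτ : τ (m + n + 1) = τ m
    · simp only [dividedDiff, hτ, if_true]
      have := W.smul_mem ((Nat.factorial (n + 1) : ℝ)⁻¹)
        (h m (n + 1) le_rfl le_rfl (Or.inr (by rw [← hτ, add_assoc])))
      convert this using 1
      funext x
      simp [div_eq_inv_mul]
    · simp only [dividedDiff, hτ, if_false]
      have h1 := ih (m + 1) fun l i hl hi => h l i (by omega) (by omega)
      have h2 := ih m fun l i hl hi => h l i (by omega) (by omega)
      have := W.smul_mem ((τ (m + n + 1) - τ m)⁻¹) (W.sub_mem h1 h2)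
      convert this using 1
      funext x
      simp [div_eq_inv_mul]

lemma iteratedDeriv_monomial (N i : ℕ) (t : ℝ) :
    iteratedDeriv i (fun t : ℝ => t ^ N) t = N.descFactorial i * t ^ (N - i) := by
  rw [iteratedDeriv_eq_iterate, iter_deriv_pow, ← descPochhammer_eval_eq_prod_range,
    descPochhammer_eval_eq_descFactorial]

lemma dividedDiff_of_eq (f : ℝ → ℝ) {τ : ℕ → ℝ} {n m : ℕ} (h : τ (m + n) = τ m) :
    dividedDiff f τ n m = iteratedDeriv n f (τ m) / (Nat.factorial n : ℝ) := by
  cases n with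
  | zero => simp [dividedDiff]
  | succ n => simp [dividedDiff, show τ (m + n + 1) = τ m from h]

/-- Leibniz rule for the divided differences of monomials. -/
lemma dividedDiff_monomial_succ {τ : ℕ → ℝ} (hτ : Monotone τ) (N n m : ℕ) :
    dividedDiff (fun t => t ^ (N + 1)) τ (n + 1) m =
      τ m * dividedDiff (fun t => t ^ N) τ (n + 1) m + dividedDiff (fun t => t ^ N) τ n (m + 1) ∧
    dividedDiff (fun t => t ^ (N + 1)) τ (n + 1) m =
      τ (m + n + 1) * dividedDiff (fun t => t ^ N) τ (n + 1) m +
        dividedDiff (fun t => t ^ N) τ n m := by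
  induction n generalizing m with
  | zero =>
    by_cases h : τ (m + 1) = τ m
    · rw [dividedDiff_of_eq _ (n := 0 + 1) (by simpa using h),
        dividedDiff_of_eq _ (n := 0 + 1) (by simpa using h)]
      simp only [dividedDiff, iteratedDeriv_monomial, add_zero, h, Nat.add_sub_cancel, zero_add,
        Nat.descFactorial_one, Nat.factorial_one, Nat.cast_one, div_one, and_self]
      cases N with
      | zero => simp
      | succ N => push_cast; simp [pow_succ]; ring
    · have h' : τ (m + 1) - τ m ≠ 0 := sub_ne_zero.2 h
      simp only [dividedDiff, add_zero, h, if_false]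
      constructor <;> (field_simp; ring)
  | succ n ih =>
    by_cases h : τ (m + (n + 1) + 1) = τ m
    · have a1 : τ (m + 1) = τ m :=
        le_antisymm (h ▸ hτ (by omega)) (hτ (by omega))
      have a2 : τ (m + 1 + (n + 1)) = τ (m + 1) := by
        rw [a1, ← h]; congr 1; omega
      have a3 : τ (m + (n + 1)) = τ m :=
        le_antisymm (h ▸ hτ (by omega)) (hτ (by omega))
      have a4 : τ (m + (n + 1 + 1)) = τ m := h
      rw [dividedDiff_of_eq _ a4, dividedDiff_of_eq _ a4, dividedDiff_of_eq _ a2,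
        dividedDiff_of_eq _ a3, a1, h, and_self]
      simp only [iteratedDeriv_monomial, Nat.descFactorial_eq_factorial_mul_choose]
      have f1 : ((n + 1).factorial : ℝ) ≠ 0 := by positivity
      have f2 : ((n + 1 + 1).factorial : ℝ) ≠ 0 := by positivity
      push_cast [Nat.choose_succ_succ N (n + 1)]
      rcases lt_or_ge N (n + 1 + 1) with hN | hN
      · rw [Nat.choose_eq_zero_of_lt hN]
        field_simp
        simp
      · have : N - (n + 1) = (N - (n + 1 + 1)) + 1 := by omega
        rw [this]
        field_simp
        ring
    · have h' : τ (m + (n + 1) + 1) - τ m ≠ 0 := sub_ne_zero.2 h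
      have b1 := (ih (m + 1)).2
      have b2 := (ih m).1
      have c : τ (m + 1 + n + 1) = τ (m + (n + 1) + 1) := by congr 1; omega
      rw [c] at b1
      have e : ∀ f : ℝ → ℝ, dividedDiff f τ (n + 1 + 1) m =
          (dividedDiff f τ (n + 1) (m + 1) - dividedDiff f τ (n + 1) m) /
            (τ (m + (n + 1) + 1) - τ m) := fun f => by
        conv_lhs => rw [dividedDiff]
        rw [if_neg h]
      rw [e, e, b1, b2]
      constructor <;> (field_simp; ring)

lemma dividedDiff_monomial_eq_zero {τ : ℕ → ℝ} (hτ : Monotone τ) {N n : ℕ} (h : N < n) (m : ℕ) :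
    dividedDiff (fun t => t ^ N) τ n m = 0 := by
  induction N generalizing n m with
  | zero =>
    obtain ⟨n, rfl⟩ : ∃ k, n = k + 1 := ⟨n - 1, by omega⟩
    clear h
    induction n generalizing m with
    | zero => simp [dividedDiff]
    | succ n ih => rw [dividedDiff, ih, ih, iteratedDeriv_monomial]; simp
  | succ N ih =>
    obtain ⟨n, rfl⟩ : ∃ k, n = k + 1 := ⟨n - 1, by omega⟩
    rw [(dividedDiff_monomial_succ hτ N n m).1, ih (by omega), ih (by omega)]
    simp

/-! ### Truncated powers -/

/-- Only t = 0 needs an argument: there the function is O(|t|^{k+2}) with exponent at least 2, so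
its derivative is zero. -/
lemma hasDerivAt_max_zero_pow (k : ℕ) (t : ℝ) :
    HasDerivAt (fun t : ℝ => max 0 t ^ (k + 2)) ((k + 2) * max 0 t ^ (k + 1)) t := by
  rcases lt_trichotomy t 0 with h | h | h
  · have e : (fun t : ℝ => max 0 t ^ (k + 2)) =ᶠ[𝓝 t] fun _ => 0 := by
      filter_upwards [gt_mem_nhds h] with s hs
      simp [max_eq_left hs.le]
    rw [max_eq_left h.le]
    simpa using (hasDerivAt_const t (0 : ℝ)).congr_of_eventuallyEq e
  · subst h
    have : (fun t : ℝ => max 0 t ^ (k + 2)) =O[𝓝 0] fun t : ℝ => ‖t - 0‖ ^ (k + 2) := by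
      refine Asymptotics.IsBigO.of_bound 1 (Eventually.of_forall fun s => ?_)
      rw [norm_pow, norm_pow, norm_norm, one_mul, sub_zero, Real.norm_eq_abs, Real.norm_eq_abs,
        abs_of_nonneg (le_max_left _ _)]
      gcongr
      exact max_le (abs_nonneg _) (le_abs_self _)
    simpa using (this.hasFDerivAt (by omega)).hasDerivAt
  · have e : (fun t : ℝ => max 0 t ^ (k + 2)) =ᶠ[𝓝 t] fun t => t ^ (k + 2) := by
      filter_upwards [lt_mem_nhds h] with s hs
      rw [max_eq_right hs.le]
    rw [max_eq_right h.le]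
    simpa using (hasDerivAt_pow (k + 2) t).congr_of_eventuallyEq e

lemma iteratedDeriv_truncatedPower {n i : ℕ} (h : i < n) (x t : ℝ) :
    iteratedDeriv i (fun t : ℝ => max 0 (t - x) ^ n) t =
      n.descFactorial i * max 0 (t - x) ^ (n - i) := by
  induction i generalizing t with
  | zero => simp
  | succ i ih =>
    rw [iteratedDeriv_succ, funext fun t => ih (by omega) t]
    obtain ⟨k, hk⟩ : ∃ k, n - i = k + 2 := ⟨n - i - 2, by omega⟩
    have h1 : n - (i + 1) = k + 1 := by omega
    rw [hk, h1]
    have h2 := ((hasDerivAt_max_zero_pow k (t - x)).comp t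
      ((hasDerivAt_id t).sub_const x)).const_mul (n.descFactorial i : ℝ)
    refine h2.deriv.trans ?_
    rw [Nat.descFactorial_succ, hk]
    push_cast; ring

/-! ### Knots and B-splines -/

lemma knot_mono (d j : ℕ) : Monotone (knot d j) := fun i k h => by
  unfold knot
  gcongr

lemma knot_nonneg (d j i : ℕ) : 0 ≤ knot d j i := le_max_left _ _

lemma knot_le_one (d j i : ℕ) : knot d j i ≤ 1 := max_le zero_le_one (min_le_left _ _)

/-- The knots increase strictly from index `d` to index `d + 2 ^ j`, so a repetition must sit in the
block of zeros or in the block of ones. -/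
lemma le_or_le_of_knot_eq {d j l i : ℕ} (hi : 0 < i) (h : knot d j (l + i) = knot d j l) :
    l + i ≤ d ∨ d + 2 ^ j ≤ l := by
  by_contra! hcon
  obtain ⟨h1, h2⟩ := hcon
  have h1' : (d : ℝ) < (l + i : ℕ) := by exact_mod_cast h1
  have h2' : (l : ℝ) < d + 2 ^ j := by exact_mod_cast h2
  have hi' : (l : ℝ) < (l + i : ℕ) := by exact_mod_cast (by omega : l < l + i)
  have hp : (0 : ℝ) < 2 ^ j := by positivity
  have hB : 0 < (((l + i : ℕ) : ℝ) - d) / 2 ^ j := div_pos (by linarith) hp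
  have hA : ((l : ℝ) - d) / 2 ^ j < 1 := by rw [div_lt_one hp]; linarith
  have hAB : ((l : ℝ) - d) / 2 ^ j < (((l + i : ℕ) : ℝ) - d) / 2 ^ j := by gcongr
  unfold knot at h
  have : max 0 (min 1 (((l : ℝ) - d) / 2 ^ j)) < max 0 (min 1 ((((l + i : ℕ) : ℝ) - d) / 2 ^ j)) := by
    refine max_lt ?_ ?_
    · exact lt_max_of_lt_right (lt_min one_pos hB)
    · exact lt_max_of_lt_right (lt_min ((min_le_right _ _).trans_lt hA)
        ((min_le_right _ _).trans_lt hAB))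
  exact this.ne' h

/-- Interior indexing: no knot of the B-splines in the index set has full multiplicity. -/
lemma multiplicity_lt {d j k l i : ℕ} (hd : 2 ≤ d) (hk : k ∈ scalingIndex d j) (hl : k + 1 ≤ l)
    (hli : l + i ≤ k + 1 + d) (h : i = 0 ∨ knot d j (l + i) = knot d j l) : i < d - 1 := by
  rcases Nat.eq_zero_or_pos i with rfl | hi
  · omega
  · have h' := h.resolve_left hi.ne'
    have hk' := Finset.mem_Icc.1 hk
    rcases le_or_le_of_knot_eq hi h' with h1 | h1
    · omega
    · generalize 2 ^ j = N at *
      omega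

lemma lipschitzOn_truncatedPower (τ : ℝ) (e : ℕ) (h1 : τ ≤ 1) :
    LipschitzOnWith e (fun x : ℝ => max 0 (τ - x) ^ e) (Icc 0 1) := by
  refine LipschitzOnWith.of_dist_le_mul fun x hx y hy => ?_
  rw [Real.dist_eq, Real.dist_eq]
  refine (abs_pow_sub_pow_le _ _ _).trans ?_
  have hb : ∀ z ∈ Icc (0 : ℝ) 1, |max 0 (τ - z)| ≤ 1 := fun z hz => by
    rw [abs_of_nonneg (le_max_left _ _)]
    exact max_le zero_le_one (by linarith [hz.1])
  have h2 : max |max 0 (τ - x)| |max 0 (τ - y)| ^ (e - 1) ≤ 1 :=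
    pow_le_one₀ (le_max_of_le_left (abs_nonneg _)) (max_le (hb x hx) (hb y hy))
  have h3 : |max 0 (τ - x) - max 0 (τ - y)| ≤ |x - y| := by
    rw [max_comm 0, max_comm 0, abs_sub_comm x y]
    refine (abs_max_sub_max_le_abs _ _ _).trans (le_of_eq ?_)
    congr 1; ring
  calc |max 0 (τ - x) - max 0 (τ - y)| * e * max |max 0 (τ - x)| |max 0 (τ - y)| ^ (e - 1)
      ≤ |x - y| * e * 1 := by gcongr
    _ = _ := by simp; ring

/-- Lipschitz functions on `[0, 1]` that vanish at `1`. -/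
def lipschitzVanishAtOne : Submodule ℝ (ℝ → ℝ) where
  carrier := {φ | (∃ C, LipschitzOnWith C φ (Icc 0 1)) ∧ φ 1 = 0}
  zero_mem' := ⟨⟨0, (LipschitzWith.const 0).lipschitzOnWith⟩, rfl⟩
  add_mem' := by
    rintro u v ⟨⟨C, hC⟩, hu⟩ ⟨⟨D, hD⟩, hv⟩
    exact ⟨⟨C + D, hC.add hD⟩, by simp [hu, hv]⟩
  smul_mem' := by
    rintro c u ⟨⟨C, hC⟩, hu⟩
    exact ⟨⟨_, (lipschitzWith_smul c).comp_lipschitzOnWith hC⟩, by simp [hu]⟩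

/-- Functions on a two point set with equal values. -/
def equalValues : Submodule ℝ (Bool → ℝ) where
  carrier := {φ | φ true = φ false}
  zero_mem' := rfl
  add_mem' := by
    intro u v hu hv
    change u true + v true = u false + v false
    rw [show u true = u false from hu, show v true = v false from hv]
  smul_mem' := by
    intro c u hu
    change c • u true = c • u false
    rw [show u true = u false from hu]

lemma bspline_lipschitz {d j k : ℕ} (hd : 2 ≤ d) (hk : k ∈ scalingIndex d j) :
    (∃ C, LipschitzOnWith C (bspline d j k) (Icc 0 1)) ∧ bspline d j k 1 = 0 := by
  have h : (fun x => dividedDiff (fun t : ℝ => (max 0 (t - x)) ^ (d - 1)) (knot d j) d (k + 1)) ∈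
      lipschitzVanishAtOne := by
    refine dividedDiff_mem lipschitzVanishAtOne (fun x t => (max 0 (t - x)) ^ (d - 1)) _ _ _
      fun l i hl hli hi => ?_
    have hlt := multiplicity_lt hd hk hl hli hi
    have hL : (fun x : ℝ => max 0 (knot d j l - x) ^ (d - 1 - i)) ∈ lipschitzVanishAtOne := by
      -- The remaining exponent is at least 1, so the truncated power is zero at x = 1, beyond which
      -- no knot lies.
      refine ⟨⟨_, lipschitzOn_truncatedPower _ _ (knot_le_one d j l)⟩, ?_⟩
      simp only []
      rw [max_eq_left (by linarith [knot_le_one d j l]), zero_pow (by omega)]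
    simp_rw [iteratedDeriv_truncatedPower hlt]
    exact lipschitzVanishAtOne.smul_mem ((d - 1).descFactorial i : ℝ) hL
  exact lipschitzVanishAtOne.smul_mem
    ((2 : ℝ) ^ ((j : ℝ) / 2) * (knot d j (k + d + 1) - knot d j (k + 1))) h

/-- Knots are nonnegative, so at x = 0 the truncated power and the monomial of degree d - 1 have the
same data at every knot, including the derivatives needed for repeated knots. Their divided
differences agree, and one of order d annihilates degree d - 1. The two-point index set lets
`dividedDiff_mem` express this comparison. -/
lemma bspline_zero {d j k : ℕ} (hd : 2 ≤ d) (hk : k ∈ scalingIndex d j) :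
    bspline d j k 0 = 0 := by
  have h : (fun b : Bool => dividedDiff (fun t : ℝ => bif b then (max 0 (t - 0)) ^ (d - 1) else
      t ^ (d - 1)) (knot d j) d (k + 1)) ∈ equalValues := by
    refine dividedDiff_mem equalValues
      (fun b t => bif b then (max 0 (t - 0)) ^ (d - 1) else t ^ (d - 1)) _ _ _
      fun l i hl hli hi => ?_
    have hlt := multiplicity_lt hd hk hl hli hi
    change iteratedDeriv i (fun t : ℝ => max 0 (t - 0) ^ (d - 1)) (knot d j l) =
      iteratedDeriv i (fun t : ℝ => t ^ (d - 1)) (knot d j l)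
    rw [iteratedDeriv_truncatedPower hlt, iteratedDeriv_monomial, sub_zero,
      max_eq_right (knot_nonneg d j l)]
  have h' : dividedDiff (fun t : ℝ => (max 0 (t - 0)) ^ (d - 1)) (knot d j) d (k + 1) =
      dividedDiff (fun t : ℝ => t ^ (d - 1)) (knot d j) d (k + 1) := h
  rw [bspline, h', dividedDiff_monomial_eq_zero (knot_mono d j) (by omega), mul_zero]

/-- Lipschitz functions on `[a, b]` that vanish at both ends. -/
def lipschitzVanish (a b : ℝ) : Submodule ℂ (ℝ → ℂ) where
  carrier := {u | (∃ C, LipschitzOnWith C u (Icc a b)) ∧ u a = 0 ∧ u b = 0}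
  zero_mem' := ⟨⟨0, (LipschitzWith.const 0).lipschitzOnWith⟩, rfl, rfl⟩
  add_mem' := by
    rintro u v ⟨⟨C, hC⟩, hu, hu'⟩ ⟨⟨D, hD⟩, hv, hv'⟩
    exact ⟨⟨C + D, hC.add hD⟩, by simp [hu, hv], by simp [hu', hv']⟩
  smul_mem' := by
    rintro c u ⟨⟨C, hC⟩, hu, hu'⟩
    exact ⟨⟨_, (lipschitzWith_smul c).comp_lipschitzOnWith hC⟩, by simp [hu], by simp [hu']⟩

lemma scaling_mem {a b : ℝ} (hab : a < b) {d j k : ℕ} (hd : 2 ≤ d) (hk : k ∈ scalingIndex d j) :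
    scaling a b d j k ∈ lipschitzVanish a b := by
  obtain ⟨⟨C, hC⟩, h1⟩ := bspline_lipschitz hd hk
  have hba : 0 < b - a := sub_pos.2 hab
  have hg : LipschitzWith (Real.nnabs (b - a)⁻¹) fun x : ℝ => (x - a) / (b - a) :=
    LipschitzWith.of_dist_le_mul fun x y => by
      rw [Real.dist_eq, Real.dist_eq, Real.coe_nnabs, ← abs_mul]
      apply le_of_eq
      congr 1
      field_simp
      ring
  have hmaps : MapsTo (fun x : ℝ => (x - a) / (b - a)) (Icc a b) (Icc 0 1) := fun x hx =>
    ⟨div_nonneg (by linarith [hx.1]) hba.le, (div_le_one hba).2 (by linarith [hx.2])⟩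
  refine ⟨⟨_, Complex.isometry_ofReal.lipschitz.comp_lipschitzOnWith
    (hC.comp (hg.lipschitzOnWith (s := Icc a b)) hmaps)⟩, ?_, ?_⟩
  · simp [scaling, bspline_zero hd hk]
  · simp [scaling, h1, div_self hba.ne']

lemma splineSpace_le {a b : ℝ} (hab : a < b) {d : ℕ} (hd : 2 ≤ d) (J : ℕ) :
    splineSpace a b d J ≤ lipschitzVanish a b := by
  refine Submodule.span_le.2 ?_
  rintro _ ⟨k, hk, rfl⟩
  exact scaling_mem hab hd hk

/-! ### Positive definiteness of the weakly singular kernel -/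

lemma singularKernel_mul {s δ : ℝ} (hδ : 0 < δ) (u : ℝ) :
    singularKernel s (δ * u) = δ ^ (-s) * singularKernel s u := by
  rcases lt_or_ge 0 u with h | h
  · rw [singularKernel_of_pos h, singularKernel_of_pos (mul_pos hδ h), Real.mul_rpow hδ.le h.le]
  · rw [singularKernel_of_nonpos h, singularKernel_of_nonpos
      (mul_nonpos_of_nonneg_of_nonpos hδ.le h), mul_zero]

/-- The product lives on (0,1), where one of v and 1 - v is at least 1/2; the corresponding factor
is bounded and the other is integrable. The exponent -|s| in the bound covers negative s as well. -/
lemma integrable_singularKernel_mul_reflected {s : ℝ} (hs : s < 1) :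
    Integrable fun v => singularKernel s (1 - v) * singularKernel s v := by
  have h0 : Integrable ((Ioc 0 1).indicator (singularKernel s)) :=
    (integrableOn_singularKernel hs 0 1).integrable_indicator measurableSet_Ioc
  have h1 := h0.comp_sub_left 1
  refine ((h0.add h1).const_mul ((2 : ℝ)⁻¹ ^ (-|s|))).mono'
    (by fun_prop : Measurable _).aestronglyMeasurable (Eventually.of_forall fun v => ?_)
  have hc : ∀ v : ℝ, 2⁻¹ ≤ v → v ≤ 1 → singularKernel s v ≤ (2 : ℝ)⁻¹ ^ (-|s|) := by
    intro v hv hv1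
    have hv0 : 0 < v := by linarith
    rw [singularKernel_of_pos hv0]
    calc v ^ (-s) ≤ v ^ (-|s|) :=
          Real.rpow_le_rpow_of_exponent_ge hv0 hv1 (neg_le_neg (le_abs_self s))
      _ ≤ _ := Real.rpow_le_rpow_of_nonpos (by norm_num) hv (neg_nonpos.2 (abs_nonneg s))
  have hn := singularKernel_nonneg s
  have hC : (0 : ℝ) ≤ (2 : ℝ)⁻¹ ^ (-|s|) := by positivity
  rw [Real.norm_of_nonneg (mul_nonneg (hn _) (hn _))]
  by_cases hv : 0 < v ∧ v < 1
  · have e1 : (Ioc 0 1).indicator (singularKernel s) v = singularKernel s v :=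
      indicator_of_mem (mem_Ioc.2 ⟨hv.1, hv.2.le⟩) _
    have e2 : (Ioc 0 1).indicator (singularKernel s) (1 - v) = singularKernel s (1 - v) :=
      indicator_of_mem (mem_Ioc.2 ⟨by linarith [hv.2], by linarith [hv.1]⟩) _
    simp only [Pi.add_apply, e1, e2]
    rcases le_total v 2⁻¹ with h | h
    · have := mul_le_mul_of_nonneg_right (hc (1 - v) (by linarith) (by linarith [hv.1])) (hn v)
      have := mul_nonneg hC (hn (1 - v))
      linarith
    · have := mul_le_mul_of_nonneg_right (hc v h hv.2.le) (hn (1 - v))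
      have := mul_nonneg hC (hn v)
      linarith
  · have : singularKernel s (1 - v) * singularKernel s v = 0 := by
      by_cases h : 0 < v
      · rw [singularKernel_of_nonpos (u := 1 - v), zero_mul]
        by_contra! h'
        exact hv ⟨h, by linarith⟩
      · rw [singularKernel_of_nonpos (u := v) (not_lt.1 h), mul_zero]
    rw [this]
    exact mul_nonneg hC (add_nonneg (indicator_nonneg (fun _ _ => hn _) _)
      (indicator_nonneg (fun _ _ => hn _) _))

/-- Near 0 the shifted factor is at most 1; for v > 1 the product is at most v^{-2s}, integrable at
infinity exactly because s > 1/2. -/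
lemma integrable_singularKernel_mul_shifted {s : ℝ} (hs : s < 1) (hs2 : 1 / 2 < s) :
    Integrable fun v => singularKernel s v * singularKernel s (v + 1) := by
  have h0 : Integrable ((Ioc 0 1).indicator (singularKernel s)) :=
    (integrableOn_singularKernel hs 0 1).integrable_indicator measurableSet_Ioc
  have h1 : Integrable ((Ioi 1).indicator fun v : ℝ => v ^ (-(2 * s))) :=
    (integrableOn_Ioi_rpow_of_lt (by linarith) one_pos).integrable_indicator measurableSet_Ioi
  refine (h0.add h1).mono' (by fun_prop : Measurable _).aestronglyMeasurable
    (Eventually.of_forall fun v => ?_)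
  have hn := singularKernel_nonneg s
  rw [Real.norm_of_nonneg (mul_nonneg (hn _) (hn _)), Pi.add_apply]
  rcases le_or_gt v 0 with h | h
  · rw [singularKernel_of_nonpos h, zero_mul]
    exact add_nonneg (indicator_nonneg (fun _ _ => hn _) _)
      (indicator_nonneg (fun x hx => Real.rpow_nonneg (zero_le_one.trans (le_of_lt hx)) _) _)
  · have hv1 : (0 : ℝ) < v + 1 := by linarith
    rcases le_or_gt v 1 with h1 | h1
    · rw [indicator_of_mem (s := Ioc 0 1) ⟨h, h1⟩, indicator_of_notMem (s := Ioi 1) (not_lt.2 h1),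
        add_zero, singularKernel_of_pos hv1]
      refine mul_le_of_le_one_right (hn v) ?_
      exact Real.rpow_le_one_of_one_le_of_nonpos (by linarith) (by linarith)
    · rw [indicator_of_notMem (s := Ioc 0 1) (fun h' => not_lt.2 h'.2 h1),
        indicator_of_mem (s := Ioi 1) h1, zero_add, singularKernel_of_pos h,
        singularKernel_of_pos hv1, show -(2 * s) = -s + -s by ring, Real.rpow_add h]
      exact mul_le_mul_of_nonneg_left
        (Real.rpow_le_rpow_of_nonpos h (by linarith) (by linarith)) (Real.rpow_nonneg h.le _)

lemma integral_singularKernel_mul_shifted_pos {s : ℝ} (hs : s < 1) (hs2 : 1 / 2 < s) :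
    0 < ∫ v, singularKernel s v * singularKernel s (v + 1) := by
  have hn := singularKernel_nonneg s
  rw [integral_pos_iff_support_of_nonneg (fun v => mul_nonneg (hn _) (hn _))
    (integrable_singularKernel_mul_shifted hs hs2)]
  refine lt_of_lt_of_le ?_ (measure_mono (s := Ioi (0 : ℝ)) fun v hv => ?_)
  · simp
  · have hv : 0 < v := hv
    rw [Function.mem_support, singularKernel_of_pos hv,
      singularKernel_of_pos (by linarith : 0 < v + 1)]
    positivity

/-! ### Composition of weakly singular kernels by scaling -/

lemma integral_comp_affine (F : ℝ → ℝ) {δ : ℝ} (hδ : 0 < δ) (ξ : ℝ) :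
    ∫ x, F (δ⁻¹ * (x - ξ)) = δ * ∫ v, F v := by
  rw [integral_sub_right_eq_self (fun x => F (δ⁻¹ * x)) ξ, Measure.integral_comp_mul_left]
  simp [abs_of_pos hδ]

lemma integrable_comp_affine {F : ℝ → ℝ} (hF : Integrable F) {δ : ℝ} (hδ : 0 < δ) (ξ : ℝ) :
    Integrable fun x => F (δ⁻¹ * (x - ξ)) :=
  (hF.comp_mul_left' (inv_ne_zero hδ.ne')).comp_sub_right ξ

lemma singularKernel_reflected_scaling (s : ℝ) {ξ η : ℝ} (h : η < ξ) (x : ℝ) :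
    singularKernel s (ξ - x) * singularKernel s (x - η) = (ξ - η) ^ (-(2 * s)) *
      (singularKernel s (1 - (ξ - η)⁻¹ * (x - η)) * singularKernel s ((ξ - η)⁻¹ * (x - η))) := by
  have hδ : 0 < ξ - η := sub_pos.2 h
  have e1 : (ξ - η) * (1 - (ξ - η)⁻¹ * (x - η)) = ξ - x := by field_simp; ring
  have e2 : (ξ - η) * ((ξ - η)⁻¹ * (x - η)) = x - η := by field_simp
  have k1 := singularKernel_mul (s := s) hδ (1 - (ξ - η)⁻¹ * (x - η))
  have k2 := singularKernel_mul (s := s) hδ ((ξ - η)⁻¹ * (x - η))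
  rw [e1] at k1
  rw [e2] at k2
  rw [k1, k2, show -(2 * s) = -s + -s by ring, Real.rpow_add hδ]
  ring

lemma singularKernel_shifted_scaling (s : ℝ) {ξ η : ℝ} (h : η < ξ) (x : ℝ) :
    singularKernel s (η - x) * singularKernel s (ξ - x) = (ξ - η) ^ (-(2 * s)) *
      (singularKernel s (-((ξ - η)⁻¹ * (x - η))) *
        singularKernel s (-((ξ - η)⁻¹ * (x - η)) + 1)) := by
  have hδ : 0 < ξ - η := sub_pos.2 h
  have e1 : (ξ - η) * (-((ξ - η)⁻¹ * (x - η)) + 1) = ξ - x := by field_simp; ring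
  have e2 : (ξ - η) * (-((ξ - η)⁻¹ * (x - η))) = η - x := by field_simp; ring
  have k1 := singularKernel_mul (s := s) hδ (-((ξ - η)⁻¹ * (x - η)) + 1)
  have k2 := singularKernel_mul (s := s) hδ (-((ξ - η)⁻¹ * (x - η)))
  rw [e1] at k1
  rw [e2] at k2
  rw [k1, k2, show -(2 * s) = -s + -s by ring, Real.rpow_add hδ]
  ring

lemma rpow_mul_self_eq {s δ : ℝ} (hδ : 0 < δ) (c : ℝ) :
    δ ^ (-(2 * s)) * (δ * c) = c * singularKernel (2 * s - 1) δ := by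
  rw [singularKernel_of_pos hδ, show -(2 * s - 1) = -(2 * s) + 1 by ring, Real.rpow_add hδ,
    Real.rpow_one]
  ring

/-- For η < ξ, the map x = η + (ξ-η)v pulls out (ξ-η)^{-2s} from homogeneity and ξ-η from dx,
leaving a constant. For ξ ≤ η the two factors are never positive together. -/
lemma integral_singularKernel_reflected {s : ℝ} (hs : s < 1) (ξ η : ℝ) :
    Integrable (fun x => singularKernel s (ξ - x) * singularKernel s (x - η)) ∧
    ∫ x, singularKernel s (ξ - x) * singularKernel s (x - η) =
      (∫ v, singularKernel s (1 - v) * singularKernel s v) *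
        singularKernel (2 * s - 1) (ξ - η) := by
  rcases lt_or_ge η ξ with h | h
  · simp_rw [singularKernel_reflected_scaling s h]
    have hδ : 0 < ξ - η := sub_pos.2 h
    refine ⟨(integrable_comp_affine (integrable_singularKernel_mul_reflected hs) hδ η).const_mul _,
      ?_⟩
    rw [integral_const_mul, integral_comp_affine
      (fun v => singularKernel s (1 - v) * singularKernel s v) hδ, rpow_mul_self_eq hδ]
  · have : (fun x => singularKernel s (ξ - x) * singularKernel s (x - η)) = fun _ => 0 := by
      funext x
      rcases le_or_gt ξ x with hx | hx
      · rw [singularKernel_of_nonpos (sub_nonpos.2 hx), zero_mul]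
      · rw [singularKernel_of_nonpos (u := x - η) (by linarith), mul_zero]
    rw [this, singularKernel_of_nonpos (sub_nonpos.2 h)]
    simp

lemma integral_singularKernel_shifted {s : ℝ} (hs : s < 1) (hs2 : 1 / 2 < s) {ξ η : ℝ}
    (h : η < ξ) :
    Integrable (fun x => singularKernel s (η - x) * singularKernel s (ξ - x)) ∧
    ∫ x, singularKernel s (η - x) * singularKernel s (ξ - x) =
      (∫ v, singularKernel s v * singularKernel s (v + 1)) *
        singularKernel (2 * s - 1) (ξ - η) := by
  simp_rw [singularKernel_shifted_scaling s h]
  have hδ : 0 < ξ - η := sub_pos.2 h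
  refine ⟨(integrable_comp_affine
    (integrable_singularKernel_mul_shifted hs hs2).comp_neg hδ η).const_mul _, ?_⟩
  rw [integral_const_mul, integral_comp_affine
    (fun v => singularKernel s (-v) * singularKernel s (-v + 1)) hδ,
    integral_neg_eq_self (fun v => singularKernel s v * singularKernel s (v + 1)),
    rpow_mul_self_eq hδ]

/-- Product of two kernel transforms, integrated: the composition kernel appears. -/
lemma integral_mul_transforms {A B : ℝ → ℝ → ℝ} (hA : Measurable (Function.uncurry A))
    (hB : Measurable (Function.uncurry B)) (hA0 : ∀ x ξ, 0 ≤ A x ξ) (hB0 : ∀ x ξ, 0 ≤ B x ξ)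
    {ν : Measure ℝ} [SFinite ν] {w : ℝ → ℝ} (hw : AEStronglyMeasurable w ν) {N : ℝ × ℝ → ℝ}
    (hN : ∀ᵐ p ∂(ν.prod ν), Integrable (fun x => A x p.1 * B x p.2) ∧
      ∫ x, A x p.1 * B x p.2 = N p)
    (hint : Integrable (fun p => N p * (w p.1 * w p.2)) (ν.prod ν)) :
    Integrable (fun x => (∫ ξ, A x ξ * w ξ ∂ν) * ∫ η, B x η * w η ∂ν) ∧
    ∫ x, (∫ ξ, A x ξ * w ξ ∂ν) * (∫ η, B x η * w η ∂ν) =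
      ∫ p, N p * (w p.1 * w p.2) ∂(ν.prod ν) := by
  have hww : AEStronglyMeasurable (fun p : ℝ × ℝ => w p.1 * w p.2) (ν.prod ν) :=
    hw.comp_fst.mul hw.comp_snd
  -- Because the kernels are nonnegative, integrating the absolute value over x gives N times |w w|,
  -- so the assumed integrability is already absolute convergence of the triple integral.
  have hG : Integrable (fun z : (ℝ × ℝ) × ℝ => A z.2 z.1.1 * B z.2 z.1.2 * (w z.1.1 * w z.1.2))
      ((ν.prod ν).prod volume) := by
    have hAm : Measurable fun z : (ℝ × ℝ) × ℝ => A z.2 z.1.1 :=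
      hA.comp (measurable_snd.prodMk (measurable_fst.comp measurable_fst))
    have hBm : Measurable fun z : (ℝ × ℝ) × ℝ => B z.2 z.1.2 :=
      hB.comp (measurable_snd.prodMk (measurable_snd.comp measurable_fst))
    have hm : AEStronglyMeasurable (fun z : (ℝ × ℝ) × ℝ =>
        A z.2 z.1.1 * B z.2 z.1.2 * (w z.1.1 * w z.1.2)) ((ν.prod ν).prod volume) :=
      (hAm.mul hBm).aestronglyMeasurable.mul hww.comp_fst
    rw [integrable_prod_iff hm]
    constructor
    · filter_upwards [hN] with p hp using hp.1.mul_const _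
    · refine hint.norm.congr ?_
      filter_upwards [hN] with p hp
      have : ∀ x, ‖A x p.1 * B x p.2 * (w p.1 * w p.2)‖ =
          A x p.1 * B x p.2 * ‖w p.1 * w p.2‖ := fun x => by
        rw [norm_mul, Real.norm_of_nonneg (mul_nonneg (hA0 _ _) (hB0 _ _))]
      simp_rw [this]
      rw [integral_mul_const, hp.2, norm_mul, Real.norm_of_nonneg]
      rw [← hp.2]
      exact integral_nonneg fun x => mul_nonneg (hA0 _ _) (hB0 _ _)
  have e : ∀ x, ∫ p, A x p.1 * B x p.2 * (w p.1 * w p.2) ∂(ν.prod ν) =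
      (∫ ξ, A x ξ * w ξ ∂ν) * ∫ η, B x η * w η ∂ν := fun x => by
    rw [← integral_prod_mul]
    refine integral_congr_ae (Eventually.of_forall fun p => ?_)
    simp only []; ring
  constructor
  · exact hG.integral_prod_right.congr (Eventually.of_forall e)
  · simp_rw [← e]
    rw [← integral_integral_swap hG]
    refine integral_congr_ae ?_
    filter_upwards [hN] with p hp
    rw [integral_mul_const, hp.2]

lemma integrable_singularKernel_quadratic {s : ℝ} (hs : s < 1) {a b : ℝ} {w : ℝ → ℝ}
    (hw : AEStronglyMeasurable w (volume.restrict (Ioc a b))) {C : ℝ} (hC : ∀ x, ‖w x‖ ≤ C) :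
    Integrable (fun p : ℝ × ℝ => singularKernel s (p.1 - p.2) * (w p.1 * w p.2))
      ((volume.restrict (Ioc a b)).prod (volume.restrict (Ioc a b))) := by
  have hwi : IntegrableOn w (Ioc a b) := Integrable.of_bound hw C (Eventually.of_forall hC)
  refine ((integrable_singularKernel_smul hs hwi).bdd_mul hw.comp_fst (c := C)
    (Eventually.of_forall fun p => hC p.1)).congr (Eventually.of_forall fun p => ?_)
  simp only [smul_eq_mul]; ring

/-- The product of the left and right fractional integrals of a bounded function has nonnegative
integral. -/
lemma integral_left_mul_right_nonneg {s : ℝ} (hs : s < 1) (hs2 : 1 / 2 < s) {a b : ℝ} {w : ℝ → ℝ}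
    (hw : AEStronglyMeasurable w (volume.restrict (Ioc a b))) {C : ℝ} (hC : ∀ x, ‖w x‖ ≤ C) :
    Integrable (fun x => (∫ ξ in Ioc a b, singularKernel s (ξ - x) * w ξ) *
      ∫ ξ in Ioc a b, singularKernel s (x - ξ) * w ξ) ∧
    0 ≤ ∫ x, (∫ ξ in Ioc a b, singularKernel s (ξ - x) * w ξ) *
      ∫ ξ in Ioc a b, singularKernel s (x - ξ) * w ξ := by
  have hn := singularKernel_nonneg s
  have hX := integrable_singularKernel_quadratic (s := 2 * s - 1) (by linarith) hw hC
  set ν := volume.restrict (Ioc a b) with hν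
  set X := ∫ p, singularKernel (2 * s - 1) (p.1 - p.2) * (w p.1 * w p.2) ∂(ν.prod ν) with hXdef
  set c₁ := ∫ v, singularKernel s (1 - v) * singularKernel s v
  set c₂ := ∫ v, singularKernel s v * singularKernel s (v + 1)
  have hc₁ : 0 ≤ c₁ := integral_nonneg fun v => mul_nonneg (hn _) (hn _)
  have hc₂ : 0 < c₂ := integral_singularKernel_mul_shifted_pos hs hs2
  have hm1 : Measurable (Function.uncurry fun x ξ => singularKernel s (ξ - x)) := by
    unfold Function.uncurry; fun_prop
  have hm2 : Measurable (Function.uncurry fun x ξ => singularKernel s (x - ξ)) := by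
    unfold Function.uncurry; fun_prop
  -- Right times left transform: the integral equals c₁ X.
  have S1 := integral_mul_transforms hm1 hm2 (fun _ _ => hn _) (fun _ _ => hn _) hw
    (N := fun p => c₁ * singularKernel (2 * s - 1) (p.1 - p.2))
    (Eventually.of_forall fun p => integral_singularKernel_reflected hs p.1 p.2)
    (by simpa only [mul_assoc] using hX.const_mul c₁)
  have hXs : Integrable (fun p : ℝ × ℝ => singularKernel (2 * s - 1) (p.2 - p.1) *
      (w p.1 * w p.2)) (ν.prod ν) := by
    refine hX.swap.congr (Eventually.of_forall fun p => ?_)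
    simp only [Function.comp, Prod.fst_swap, Prod.snd_swap]; ring
  have hXs' : ∫ p : ℝ × ℝ, singularKernel (2 * s - 1) (p.2 - p.1) *
      (w p.1 * w p.2) ∂(ν.prod ν) = X := by
    rw [hXdef, ← integral_prod_swap]
    refine integral_congr_ae (Eventually.of_forall fun p => ?_)
    simp only [Prod.fst_swap, Prod.snd_swap]; ring
  -- On the diagonal the composed kernel diverges, since v^{-2s} is not integrable at 0 for s > 1/2;
  -- the diagonal is a null set.
  have hdiag : ∀ᵐ p ∂(ν.prod ν), p.1 ≠ p.2 := by
    rw [Measure.ae_prod_iff_ae_ae]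
    · refine Eventually.of_forall fun x => ?_
      have : ∀ᵐ y : ℝ, y ≠ x := by simp [ae_iff, measure_singleton]
      filter_upwards [ae_restrict_of_ae this] with y hy using hy.symm
    · exact (measurableSet_eq_fun measurable_fst measurable_snd).compl
  have hint2 := (hX.add hXs).const_mul c₂
  have he : ∀ p : ℝ × ℝ, c₂ * (singularKernel (2 * s - 1) (p.1 - p.2) * (w p.1 * w p.2) +
      singularKernel (2 * s - 1) (p.2 - p.1) * (w p.1 * w p.2)) =
      c₂ * (singularKernel (2 * s - 1) (p.1 - p.2) + singularKernel (2 * s - 1) (p.2 - p.1)) *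
        (w p.1 * w p.2) := fun p => by ring
  -- The square of the right transform: the composed kernel is now symmetric, so the integral is c₂
  -- times X plus its reflection, that is 2c₂X. Being the integral of a square, it forces X ≥ 0.
  have S2 := integral_mul_transforms hm1 hm1 (fun _ _ => hn _) (fun _ _ => hn _) hw
    (N := fun p => c₂ * (singularKernel (2 * s - 1) (p.1 - p.2) +
      singularKernel (2 * s - 1) (p.2 - p.1)))
    (by
      filter_upwards [hdiag] with p hp
      rcases lt_or_gt_of_ne hp with h | h
      · rw [singularKernel_of_nonpos (u := p.1 - p.2) (by linarith), zero_add]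
        exact integral_singularKernel_shifted hs hs2 h
      · rw [singularKernel_of_nonpos (u := p.2 - p.1) (by linarith), add_zero]
        simp_rw [mul_comm (singularKernel s (p.1 - _))]
        exact integral_singularKernel_shifted hs hs2 h)
    (hint2.congr (Eventually.of_forall he))
  have e2 : ∫ p, c₂ * (singularKernel (2 * s - 1) (p.1 - p.2) +
      singularKernel (2 * s - 1) (p.2 - p.1)) * (w p.1 * w p.2) ∂(ν.prod ν) = c₂ * (X + X) := by
    simp_rw [← he]
    rw [integral_const_mul, integral_add hX hXs, hXs']
  have hXnn : 0 ≤ X := by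
    have h0 : 0 ≤ c₂ * (X + X) := by
      rw [← e2, ← S2.2]
      exact integral_nonneg fun x => mul_self_nonneg _
    have := nonneg_of_mul_nonneg_right h0 hc₂
    linarith
  refine ⟨S1.1, ?_⟩
  rw [S1.2]
  simp_rw [mul_assoc]
  rw [integral_const_mul]
  exact mul_nonneg hc₁ hXnn

/-! ### Riemann–Liouville derivatives of Lipschitz functions vanishing at the ends -/

/-- The primitive of the weakly singular integral of `w` is the weakly singular integral of the
primitive of `w`. -/
lemma singular_integral_primitive {s : ℝ} (hs : s < 1) {a b : ℝ} {u w : ℝ → ℂ}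
    (hw : IntegrableOn w (Ioc a b)) (hu : ∀ x ∈ Icc a b, u x = ∫ ξ in a..x, w ξ)
    {y : ℝ} (hy : y ∈ Icc a b) :
    ∫ ξ in a..y, ((y - ξ) ^ (-s) : ℝ) • u ξ =
      ∫ z in a..y, ∫ ξ in Ioc a b, singularKernel s (z - ξ) • w ξ := by
  set w₀ : ℝ → ℂ := (Ioc a b).indicator w with hw₀
  have hw₀i : Integrable w₀ := hw.integrable_indicator measurableSet_Ioc
  have hya : 0 ≤ y - a := sub_nonneg.2 hy.1
  have hk : IntegrableOn (fun v : ℝ => v ^ (-s)) (Ioc 0 (y - a)) :=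
    (intervalIntegrable_iff_integrableOn_Ioc_of_le hya).1
      (intervalIntegral.intervalIntegrable_rpow' (by linarith))
  have hint : Integrable (fun p : ℝ × ℝ => (p.2 ^ (-s) : ℝ) • w₀ (p.1 - p.2))
      ((volume.restrict (Ioc a y)).prod (volume.restrict (Ioc 0 (y - a)))) :=
    (hk.convolution_integrand (ContinuousLinearMap.lsmul ℝ ℝ) hw₀i).mono_measure
      (Measure.prod_mono Measure.restrict_le_self le_rfl)
  -- After the substitution v = y - ξ, the value u(y - v) is the integral of w(z - v) over z in (a +
  -- v, y). Extending w by zero frees the z-domain from v, and the integrals can be exchanged.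
  have h1 : ∫ ξ in a..y, ((y - ξ) ^ (-s) : ℝ) • u ξ =
      ∫ v in Ioc 0 (y - a), ∫ z in Ioc a y, (v ^ (-s) : ℝ) • w₀ (z - v) := by
    have e := intervalIntegral.integral_comp_sub_left
      (fun v => (v ^ (-s) : ℝ) • u (y - v)) y (a := a) (b := y)
    simp only [sub_sub_cancel, sub_self] at e
    rw [e, intervalIntegral.integral_of_le hya]
    refine setIntegral_congr_fun measurableSet_Ioc fun v hv => ?_
    have hI : Ioc (a + v) y = Ioc a y ∩ Ioi (a + v) := by
      ext z
      exact ⟨fun h => ⟨⟨by linarith [h.1, hv.1], h.2⟩, h.1⟩, fun h => ⟨h.2, h.1.2⟩⟩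
    have e2 : ∫ z in (a + v)..y, w (z - v) = ∫ z in Ioc a y, w₀ (z - v) := by
      rw [intervalIntegral.integral_of_le (by linarith [hv.2]), hI,
        ← setIntegral_indicator measurableSet_Ioi]
      refine setIntegral_congr_fun measurableSet_Ioc fun z hz => ?_
      simp only [hw₀]
      by_cases h : a + v < z
      · rw [indicator_of_mem (s := Ioi _) h, indicator_of_mem]
        exact ⟨by linarith, by linarith [hz.2, hy.2, hv.1]⟩
      · rw [indicator_of_notMem (s := Ioi _) h, indicator_of_notMem]
        exact fun h' => h (by linarith [h'.1])
    rw [hu (y - v) ⟨by linarith [hv.2], by linarith [hv.1, hy.2]⟩, integral_smul, ← e2,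
      intervalIntegral.integral_comp_sub_right (fun z => w z), add_sub_cancel_right]
  rw [h1, ← integral_integral_swap (f := fun z v => (v ^ (-s) : ℝ) • w₀ (z - v)) hint,
    intervalIntegral.integral_of_le hy.1]
  refine setIntegral_congr_fun measurableSet_Ioc fun z hz => ?_
  have e3 : ∫ v in Ioc 0 (y - a), (v ^ (-s) : ℝ) • w₀ (z - v) =
      ∫ v, singularKernel s v • w₀ (z - v) := by
    rw [← integral_indicator measurableSet_Ioc]
    refine integral_congr_ae (Eventually.of_forall fun v => ?_)
    simp only []
    by_cases h : v ∈ Ioc 0 (y - a)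
    · rw [indicator_of_mem h, singularKernel_of_pos h.1]
    · rw [indicator_of_notMem h]
      by_cases h0 : 0 < v
      · have : z - v ∉ Ioc a b := fun h' => h ⟨h0, by linarith [h'.1, hz.2]⟩
        rw [hw₀, indicator_of_notMem this, smul_zero]
      · rw [singularKernel_of_nonpos (not_lt.1 h0), zero_smul]
  have e4 : ∫ v, singularKernel s v • w₀ (z - v) = ∫ ξ, singularKernel s (z - ξ) • w₀ ξ := by
    rw [← integral_sub_left_eq_self (fun v => singularKernel s v • w₀ (z - v)) volume z]
    simp only [sub_sub_cancel]
  rw [e3, e4, ← integral_indicator measurableSet_Ioc]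
  refine integral_congr_ae (Eventually.of_forall fun ξ => ?_)
  by_cases h : ξ ∈ Ioc a b
  · simp [hw₀, h]
  · simp [hw₀, h]

lemma lipschitzVanish_ac {a b : ℝ} (hab : a ≤ b) {u : ℝ → ℂ} (hu : u ∈ lipschitzVanish a b) :
    AbsolutelyContinuousOnInterval u a b := by
  obtain ⟨⟨C, hC⟩, -⟩ := hu
  exact LipschitzOnWith.absolutelyContinuousOnInterval (by rwa [uIcc_of_le hab])

/-- Since u(a) = 0, u is the primitive of u' and the fractional integral of u is a primitive of the
singular integral of u'. Lebesgue differentiation then gives the value almost everywhere. -/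
lemma leftRL_ae {s : ℝ} (hs : s < 1) {a b : ℝ} (hab : a ≤ b) {u : ℝ → ℂ}
    (hu : u ∈ lipschitzVanish a b) :
    ∀ᵐ x : ℝ, x ∈ Ioo a b → leftRL a s u x =
      ((Real.Gamma (1 - s))⁻¹ : ℝ) • ∫ ξ in Ioc a b, singularKernel s (x - ξ) • deriv u ξ := by
  have hac := lipschitzVanish_ac hab hu
  have hw : IntegrableOn (deriv u) (Ioc a b) :=
    (intervalIntegrable_iff_integrableOn_Ioc_of_le hab).1 (ac_intervalIntegrable_deriv hac)
  have hint : IntervalIntegrable (fun x => ∫ ξ in Ioc a b, singularKernel s (x - ξ) • deriv u ξ)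
      volume a b :=
    (intervalIntegrable_iff_integrableOn_Ioc_of_le hab).2
      (integrable_singularKernel_smul hs hw).integral_prod_left
  filter_upwards [hint.ae_hasDerivAt_integral] with x hx hxm
  have hd := hx (by rw [uIcc_of_le hab]; exact Ioo_subset_Icc_self hxm) a left_mem_uIcc
  have hev : (fun y : ℝ => ∫ ξ in a..y, ((y - ξ) ^ (-s) : ℝ) • u ξ) =ᶠ[𝓝 x]
      fun y => ∫ z in a..y, ∫ ξ in Ioc a b, singularKernel s (z - ξ) • deriv u ξ := by
    filter_upwards [Ioo_mem_nhds hxm.1 hxm.2] with y hy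
    refine singular_integral_primitive hs hw (fun z hz => ?_) (Ioo_subset_Icc_self hy)
    rw [ac_integral_deriv (hac.mono ?_), hu.2.1, sub_zero]
    rw [uIcc_of_le hab, uIcc_of_le hz.1]
    exact Icc_subset_Icc_right hz.2
  rw [leftRL, hev.deriv_eq, hd.deriv]

/-- Reflection x ↦ a + b - x exchanges the two derivatives; the minus sign in the right one cancels
the sign from the chain rule. -/
lemma rightRL_eq_leftRL (a b s : ℝ) (u : ℝ → ℂ) (x : ℝ) :
    rightRL b s u x = leftRL a s (fun x => u (a + b - x)) (a + b - x) := by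
  have h : ∀ y : ℝ, ∫ ξ in y..b, ((ξ - y) ^ (-s) : ℝ) • u ξ =
      (fun y : ℝ => ∫ ξ in a..y, ((y - ξ) ^ (-s) : ℝ) • u (a + b - ξ)) (a + b - y) := fun y => by
    have e := intervalIntegral.integral_comp_sub_left
      (fun ζ => ((ζ - y) ^ (-s) : ℝ) • u ζ) (a + b) (a := a) (b := a + b - y)
    simp only [sub_sub_cancel, add_sub_cancel_left] at e
    rw [← e]
    refine intervalIntegral.integral_congr fun ξ _ => ?_
    congr 2
    ring
  rw [rightRL, leftRL, funext h, deriv_comp_const_sub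
    (f := fun y : ℝ => ∫ ξ in a..y, ((y - ξ) ^ (-s) : ℝ) • u (a + b - ξ)),
    smul_neg, neg_smul, neg_neg]

lemma reflect_mem {a b : ℝ} {u : ℝ → ℂ} (hu : u ∈ lipschitzVanish a b) :
    (fun x => u (a + b - x)) ∈ lipschitzVanish a b := by
  obtain ⟨⟨C, hC⟩, ha, hb⟩ := hu
  refine ⟨⟨C * 1, hC.comp (g := u) (f := fun x => a + b - x) (s := Icc a b) ?_ ?_⟩, ?_, ?_⟩
  · exact (LipschitzWith.of_dist_le_mul fun x y => by
      rw [Real.dist_eq, Real.dist_eq, abs_sub_comm x y, NNReal.coe_one, one_mul]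
      apply le_of_eq
      congr 1
      ring).lipschitzOnWith
  · exact fun x hx => ⟨by linarith [hx.2], by linarith [hx.1]⟩
  · simpa using hb
  · simpa using ha

lemma rightRL_ae {s : ℝ} (hs : s < 1) {a b : ℝ} (hab : a ≤ b) {u : ℝ → ℂ}
    (hu : u ∈ lipschitzVanish a b) :
    ∀ᵐ x : ℝ, x ∈ Ioo a b → rightRL b s u x =
      -(((Real.Gamma (1 - s))⁻¹ : ℝ) • ∫ ξ in Ioc a b, singularKernel s (ξ - x) • deriv u ξ) := by
  have h := leftRL_ae hs hab (reflect_mem hu)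
  have h' := (Measure.measurePreserving_sub_left volume (a + b)).quasiMeasurePreserving.ae h
  filter_upwards [h'] with x hx hxm
  rw [rightRL_eq_leftRL a, hx ⟨by linarith [hxm.2], by linarith [hxm.1]⟩, ← smul_neg]
  congr 1
  simp_rw [deriv_comp_const_sub, smul_neg]
  rw [integral_neg, ← intervalIntegral.integral_of_le hab, ← intervalIntegral.integral_of_le hab]
  congr 1
  have e := intervalIntegral.integral_comp_sub_left
      (fun ζ => singularKernel s (ζ - x) • deriv u ζ) (a + b) (a := a) (b := b)
  simp only [add_sub_cancel_left, add_sub_cancel_right] at e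
  rw [← e]
  refine intervalIntegral.integral_congr fun ξ _ => ?_
  congr 2
  ring

/-! ### Sign of the Riesz form -/

lemma l2Inner_conj (a b : ℝ) (u v : ℝ → ℂ) :
    l2Inner a b u v = (starRingEnd ℂ) (l2Inner a b v u) := by
  rw [l2Inner, l2Inner, ← integral_conj]
  simp [mul_comm]

lemma integrable_singularKernel_smul_bounded {E : Type*} [NormedAddCommGroup E] [NormedSpace ℝ E]
    {s : ℝ} (hs : s < 1) {a b : ℝ} {g : ℝ → E}
    (hg : AEStronglyMeasurable g (volume.restrict (Ioc a b))) {C : ℝ} (hC : ∀ x, ‖g x‖ ≤ C)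
    (x : ℝ) :
    IntegrableOn (fun ξ => singularKernel s (x - ξ) • g ξ) (Ioc a b) ∧
    IntegrableOn (fun ξ => singularKernel s (ξ - x) • g ξ) (Ioc a b) := by
  have hk : ∀ c d, Integrable ((Ioc c d).indicator (singularKernel s)) := fun c d =>
    (integrableOn_singularKernel hs c d).integrable_indicator measurableSet_Ioc
  have hbd : ∀ κ : ℝ → ℝ, Measurable κ → (∀ ξ, 0 ≤ κ ξ) → IntegrableOn κ (Ioc a b) →
      IntegrableOn (fun ξ => κ ξ • g ξ) (Ioc a b) := fun κ hm h0 hi =>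
    (Integrable.mul_const hi C).mono' (hm.aestronglyMeasurable.smul hg)
      (Eventually.of_forall fun ξ => by
        rw [norm_smul, Real.norm_of_nonneg (h0 ξ)]
        exact mul_le_mul_of_nonneg_left (hC ξ) (h0 ξ))
  constructor
  · refine hbd _ (by fun_prop) (fun _ => singularKernel_nonneg _ _) ?_
    refine ((hk (x - b - 1) (x - a)).comp_sub_left x).integrableOn.congr_fun (fun ξ hξ => ?_)
      measurableSet_Ioc
    exact indicator_of_mem (mem_Ioc.2 ⟨by linarith [hξ.2], by linarith [hξ.1]⟩) _
  · refine hbd _ (by fun_prop) (fun _ => singularKernel_nonneg _ _) ?_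
    refine ((hk (a - x) (b - x)).comp_sub_right x).integrableOn.congr_fun (fun ξ hξ => ?_)
      measurableSet_Ioc
    exact indicator_of_mem (mem_Ioc.2 ⟨by linarith [hξ.1], by linarith [hξ.2]⟩) _

/-- The right derivative carries a minus sign, so the real part is a negative multiple of the
left-right pairing, applied separately to the real and imaginary parts of u'. -/
lemma l2Inner_left_right_re_nonpos {s : ℝ} (hs : s < 1) (hs2 : 1 / 2 < s) {a b : ℝ} (hab : a ≤ b)
    {u : ℝ → ℂ} (hu : u ∈ lipschitzVanish a b) :
    (l2Inner a b (leftRL a s u) (rightRL b s u)).re ≤ 0 := by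
  obtain ⟨C, hC⟩ := hu.1
  -- Only inside the open interval is the derivative controlled by the Lipschitz constant; cutting
  -- it off gives a bound valid everywhere without changing the integrals.
  set w : ℝ → ℂ := (Ioo a b).indicator (deriv u) with hw
  have hwm : Measurable w := (measurable_deriv u).indicator measurableSet_Ioo
  have hwC : ∀ x, ‖w x‖ ≤ C := fun x => by
    by_cases h : x ∈ Ioo a b
    · rw [hw, indicator_of_mem h]
      exact norm_deriv_le_of_lipschitzOn (Icc_mem_nhds h.1 h.2) hC
    · rw [hw, indicator_of_notMem h, norm_zero]; exact C.2
  have hwk : ∀ k : ℝ → ℝ, ∫ ξ in Ioc a b, k ξ • deriv u ξ = ∫ ξ in Ioc a b, k ξ • w ξ :=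
    fun k => by
      rw [integral_Ioc_eq_integral_Ioo, integral_Ioc_eq_integral_Ioo]
      exact setIntegral_congr_fun measurableSet_Ioo fun ξ hξ => by simp [hw, hξ]
  set L : ℝ → ℂ := fun x => ∫ ξ in Ioc a b, singularKernel s (x - ξ) • w ξ
  set R : ℝ → ℂ := fun x => ∫ ξ in Ioc a b, singularKernel s (ξ - x) • w ξ
  set Γi := (Real.Gamma (1 - s))⁻¹
  have key : ∫ x in Ioo a b, (leftRL a s u x * (starRingEnd ℂ) (rightRL b s u x)).re =
      -(Γi ^ 2) * ∫ x, (R x).re * (L x).re + (R x).im * (L x).im := by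
    rw [← integral_const_mul, ← integral_indicator measurableSet_Ioo]
    refine integral_congr_ae ?_
    have hae : ∀ᵐ x : ℝ, x ≠ a ∧ x ≠ b := by
      have h1 : ∀ᵐ x : ℝ, x ≠ a := by simp [ae_iff, measure_singleton]
      have h2 : ∀ᵐ x : ℝ, x ≠ b := by simp [ae_iff, measure_singleton]
      filter_upwards [h1, h2] with x h1 h2 using ⟨h1, h2⟩
    filter_upwards [leftRL_ae hs hab hu, rightRL_ae hs hab hu] with x h1 h2
    by_cases hx : x ∈ Ioo a b
    · rw [indicator_of_mem hx, h1 hx, h2 hx, hwk, hwk]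
      simp [L, R]
      ring
    -- The inner product lives on (a,b) but the positivity result on the whole line. They agree
    -- because the left transform vanishes to the left of a and the right one to the right of b.
    · rw [indicator_of_notMem hx]
      have : L x = 0 ∨ R x = 0 := by
        rcases le_or_gt x a with h | h
        · left
          refine setIntegral_eq_zero_of_forall_eq_zero fun ξ hξ => ?_
          rw [singularKernel_of_nonpos (by linarith [hξ.1]), zero_smul]
        · right
          have hb : b ≤ x := by
            by_contra! h'
            exact hx ⟨h, h'⟩
          refine setIntegral_eq_zero_of_forall_eq_zero fun ξ hξ => ?_
          rw [singularKernel_of_nonpos (by linarith [hξ.2]), zero_smul]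
      rcases this with h | h <;> simp [h]
  have hLR := fun x => integrable_singularKernel_smul_bounded hs
    (hwm.aestronglyMeasurable (μ := volume.restrict (Ioc a b))) hwC x
  have hLre : ∀ x, (L x).re = ∫ ξ in Ioc a b, singularKernel s (x - ξ) * (w ξ).re := fun x => by
    refine (Complex.reCLM.integral_comp_comm (hLR x).1).symm.trans ?_
    simp
  have hLim : ∀ x, (L x).im = ∫ ξ in Ioc a b, singularKernel s (x - ξ) * (w ξ).im := fun x => by
    refine (Complex.imCLM.integral_comp_comm (hLR x).1).symm.trans ?_
    simp
  have hRre : ∀ x, (R x).re = ∫ ξ in Ioc a b, singularKernel s (ξ - x) * (w ξ).re := fun x => by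
    refine (Complex.reCLM.integral_comp_comm (hLR x).2).symm.trans ?_
    simp
  have hRim : ∀ x, (R x).im = ∫ ξ in Ioc a b, singularKernel s (ξ - x) * (w ξ).im := fun x => by
    refine (Complex.imCLM.integral_comp_comm (hLR x).2).symm.trans ?_
    simp
  have p1 := integral_left_mul_right_nonneg hs hs2 (a := a) (b := b) (w := fun ξ => (w ξ).re)
    (by fun_prop : Measurable _).aestronglyMeasurable
    (fun x => (Complex.abs_re_le_norm _).trans (hwC x))
  have p2 := integral_left_mul_right_nonneg hs hs2 (a := a) (b := b) (w := fun ξ => (w ξ).im)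
    (by fun_prop : Measurable _).aestronglyMeasurable
    (fun x => (Complex.abs_im_le_norm _).trans (hwC x))
  have hnn : 0 ≤ ∫ x, (R x).re * (L x).re + (R x).im * (L x).im := by
    simp_rw [hLre, hLim, hRre, hRim]
    rw [integral_add p1.1 p2.1]
    exact add_nonneg p1.2 p2.2
  rw [l2Inner]
  by_cases hi : IntegrableOn (fun x => leftRL a s u x * (starRingEnd ℂ) (rightRL b s u x)) (Ioo a b)
  · have e : (∫ x in Ioo a b, leftRL a s u x * (starRingEnd ℂ) (rightRL b s u x)).re =
        ∫ x in Ioo a b, (leftRL a s u x * (starRingEnd ℂ) (rightRL b s u x)).re :=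
      (Complex.reCLM.integral_comp_comm hi).symm
    rw [e, key]
    have := mul_nonneg (sq_nonneg Γi) hnn
    linarith
  -- If the product is not integrable, its integral is 0 by convention and the inequality still
  -- holds.
  · rw [integral_undef hi, Complex.zero_re]

/-- The form of the negative Riesz derivative is nonnegative on Lipschitz functions that vanish at
the ends of the interval. -/
lemma rieszForm_re_nonneg {a b α : ℝ} (hab : a ≤ b) (hα : 1 < α) (hα2 : α < 2) {u : ℝ → ℂ}
    (hu : u ∈ lipschitzVanish a b) : 0 ≤ (rieszForm a b α u u).re := by
  have h := l2Inner_left_right_re_nonpos (s := α / 2) (by linarith) (by linarith) hab hu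
  have hcos : Real.cos (α * Real.pi / 2) < 0 := by
    refine Real.cos_neg_of_pi_div_two_lt_of_lt ?_ ?_ <;> nlinarith [Real.pi_pos]
  rw [rieszForm, l2Inner_conj a b (rightRL b (α / 2) u), Complex.div_ofReal_re, Complex.add_re,
    Complex.conj_re]
  exact div_nonneg_of_nonpos (by linarith) (by linarith)

/-! ### The semi-discrete solution as a function of time and space -/

/-- Needed because the expansion of G in the scaling functions is available only for times in [0,T].
-/
lemma ac_congr {f g : ℝ → ℂ} {a b : ℝ} (hf : AbsolutelyContinuousOnInterval f a b)
    (h : EqOn f g (uIcc a b)) : AbsolutelyContinuousOnInterval g a b := by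
  rw [absolutelyContinuousOnInterval_iff] at hf ⊢
  intro ε hε
  obtain ⟨δ, hδ, H⟩ := hf ε hε
  refine ⟨δ, hδ, fun E hE hl => ?_⟩
  have e : ∑ i ∈ Finset.range E.1, dist (g (E.2 i).1) (g (E.2 i).2) =
      ∑ i ∈ Finset.range E.1, dist (f (E.2 i).1) (f (E.2 i).2) :=
    Finset.sum_congr rfl fun i hi => by rw [h (hE.1 i hi).1, h (hE.1 i hi).2]
  rw [e]
  exact H E hE hl

lemma ac_sum {ι : Type*} (I : Finset ι) {f : ι → ℝ → ℂ} {a b : ℝ}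
    (hf : ∀ i ∈ I, AbsolutelyContinuousOnInterval (f i) a b) :
    AbsolutelyContinuousOnInterval (fun t => ∑ i ∈ I, f i t) a b := by
  classical
  induction I using Finset.induction_on with
  | empty =>
    simpa using (LipschitzWith.const (0 : ℂ)).lipschitzOnWith.absolutelyContinuousOnInterval
  | insert i I hi ih =>
    simp_rw [Finset.sum_insert hi]
    exact (hf i (Finset.mem_insert_self i I)).fun_add
      (ih fun j hj => hf j (Finset.mem_insert_of_mem hj))

lemma lipschitzVanish_bounded {a b : ℝ} {u : ℝ → ℂ} (hu : u ∈ lipschitzVanish a b) :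
    ∃ C, ∀ x ∈ Ioo a b, ‖u x‖ ≤ C := by
  obtain ⟨⟨C, hC⟩, -⟩ := hu
  obtain ⟨D, hD⟩ := isCompact_Icc.exists_bound_of_continuousOn hC.continuousOn
  exact ⟨D, fun x hx => hD x (Ioo_subset_Icc_self hx)⟩

lemma lipschitzVanish_aestronglyMeasurable {a b : ℝ} {u : ℝ → ℂ} (hu : u ∈ lipschitzVanish a b) :
    AEStronglyMeasurable u (volume.restrict (Ioo a b)) := by
  obtain ⟨⟨C, hC⟩, -⟩ := hu
  exact (hC.continuousOn.mono Ioo_subset_Icc_self).aestronglyMeasurable measurableSet_Ioo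

lemma l2Norm_sq (a b : ℝ) (u : ℝ → ℂ) : l2Norm a b u ^ 2 = ∫ x in Ioo a b, ‖u x‖ ^ 2 :=
  Real.sq_sqrt (integral_nonneg fun _ => by positivity)

/-- Integrability in time and space of a tempered singular time integral. -/
lemma integrable_tempered_singular {γ T : ℝ} (hγ1 : γ < 1) {Ω : Set ℝ} (hΩ : MeasurableSet Ω)
    {q : ℝ → ℂ} (hq : AEStronglyMeasurable q (volume.restrict Ω)) (hq0 : ∀ x ∈ Ω, 0 ≤ (q x).re)
    {E : ℝ → ℝ → ℂ}
    (hE : AEStronglyMeasurable (fun z : (ℝ × ℝ) × ℝ => E z.2 z.1.2)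
      (((volume.restrict (Ioc 0 T)).prod (volume.restrict Ω)).prod (volume.restrict (Ioc 0 T))))
    {m h : ℝ → ℝ} (hm : IntegrableOn m Ω) (hh : IntegrableOn h (Ioc 0 T))
    (hb : ∀ s ∈ Ioc 0 T, ∀ x ∈ Ω, ‖E s x‖ ≤ m x * h s) :
    Integrable (fun z : ℝ × ℝ => ∫ s in Ioc 0 T, singularKernel γ (z.1 - s) •
      (Complex.exp (q z.2 * ((s - z.1 : ℝ) : ℂ)) * E s z.2))
      ((volume.restrict (Ioc 0 T)).prod (volume.restrict Ω)) := by
  have hk := integrable_singularKernel_smul (s := γ) hγ1 hh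
  have hmaj := hk.integral_prod_left.mul_prod hm
  have hF : AEStronglyMeasurable (fun z : (ℝ × ℝ) × ℝ => singularKernel γ (z.1.1 - z.2) •
      (Complex.exp (q z.1.2 * ((z.2 - z.1.1 : ℝ) : ℂ)) * E z.2 z.1.2))
      (((volume.restrict (Ioc 0 T)).prod (volume.restrict Ω)).prod
        (volume.restrict (Ioc 0 T))) := by
    have h1 : Measurable fun z : (ℝ × ℝ) × ℝ => singularKernel γ (z.1.1 - z.2) := by fun_prop
    have h2 : Continuous fun z : (ℝ × ℝ) × ℝ => ((z.2 - z.1.1 : ℝ) : ℂ) := by fun_prop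
    exact h1.aestronglyMeasurable.smul ((Complex.continuous_exp.comp_aestronglyMeasurable
      (hq.comp_snd.comp_fst.mul h2.aestronglyMeasurable)).mul hE)
  refine hmaj.mono' hF.integral_prod_right' ?_
  have hae : ∀ᵐ z ∂((volume.restrict (Ioc 0 T)).prod (volume.restrict Ω)),
      IntegrableOn (fun s => singularKernel γ (z.1 - s) • h s) (Ioc 0 T) :=
    Measure.quasiMeasurePreserving_fst.ae hk.prod_right_ae
  have hmem : ∀ᵐ z ∂((volume.restrict (Ioc 0 T)).prod (volume.restrict Ω)), z.2 ∈ Ω :=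
    Measure.quasiMeasurePreserving_snd.ae (ae_restrict_mem hΩ)
  filter_upwards [hae, hmem] with z hz hzΩ
  rw [← integral_mul_const]
  refine norm_integral_le_of_norm_le (hz.mul_const _) ?_
  filter_upwards [ae_restrict_mem measurableSet_Ioc] with s hs
  rcases le_or_gt z.1 s with hle | hlt
  · rw [singularKernel_of_nonpos (sub_nonpos.2 hle)]; simp
  -- The two exponentials must be combined: U is only integrable, so neither need be bounded in x,
  -- whereas for s < t the exponent q(s - t) has nonpositive real part.
  · have h1 : ‖Complex.exp (q z.2 * ((s - z.1 : ℝ) : ℂ))‖ ≤ 1 := by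
      rw [Complex.norm_exp, Real.exp_le_one_iff, Complex.re_mul_ofReal]
      exact mul_nonpos_of_nonneg_of_nonpos (hq0 _ hzΩ) (by linarith)
    have h2 := hb s hs z.2 hzΩ
    have h3 := singularKernel_nonneg γ (z.1 - s)
    rw [norm_smul, norm_mul, Real.norm_of_nonneg h3, smul_eq_mul, mul_assoc]
    refine mul_le_mul_of_nonneg_left ?_ h3
    calc _ ≤ 1 * ‖E s z.2‖ := by gcongr
      _ ≤ _ := by rw [one_mul, mul_comm]; exact h2

lemma caputoSubstantial_eq (γ : ℝ) (p : ℂ) (U : ℝ → ℝ) (G : ℝ → ℝ → ℂ) (t x : ℝ) :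
    caputoSubstantial γ p U G t x = (((Real.Gamma (1 - γ))⁻¹ : ℝ) : ℂ) *
      substantialIntegral γ (p * U x) (fun τ => G τ x) t := by
  rw [caputoSubstantial, substantialIntegral, Complex.real_smul]
  ring

lemma substantialIntegral_eq_setIntegral {γ T t : ℝ} (ht : t ∈ Icc 0 T) (q : ℂ) {y e : ℝ → ℂ}
    (he : ∀ᵐ s : ℝ, s ∈ Ioo 0 T → deriv y s + q * y s = e s) :
    substantialIntegral γ q y t = ∫ s in Ioc 0 T, singularKernel γ (t - s) •
      (Complex.exp (q * ((s - t : ℝ) : ℂ)) * e s) := by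
  rw [setIntegral_singularKernel_left γ ht, substantialIntegral,
    ← intervalIntegral.integral_const_mul]
  refine intervalIntegral.integral_congr_ae ?_
  have hne : ∀ᵐ s : ℝ, s ≠ T := by simp [ae_iff, measure_singleton]
  filter_upwards [he, hne] with s h hs hst
  rw [uIoc_of_le ht.1] at hst
  have hexp : Complex.exp (q * ((s - t : ℝ) : ℂ)) =
      Complex.exp (-(q * t)) * Complex.exp (q * s) := by
    rw [← Complex.exp_add]
    congr 1
    push_cast
    ring
  rw [← h ⟨hst.1, lt_of_le_of_ne (hst.2.trans ht.2) hs⟩, hexp, Complex.real_smul,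
    Complex.real_smul]
  ring

/-! ### Finite sums of time coefficients times space profiles -/

section Separated

variable {a b T : ℝ} {ι : Type*} {I : Finset ι} {c : ι → ℝ → ℂ} {φ : ι → ℝ → ℂ} {G : ℝ → ℝ → ℂ}

lemma separated_ac (hT : 0 ≤ T) (hc : ∀ k ∈ I, AbsolutelyContinuousOnInterval (c k) 0 T)
    (hG : ∀ t ∈ Icc (0 : ℝ) T, ∀ x : ℝ, G t x = ∑ k ∈ I, c k t * φ k x) (x : ℝ) :
    AbsolutelyContinuousOnInterval (fun t => G t x) 0 T := by
  refine ac_congr (ac_sum I (f := fun k t => φ k x • c k t) fun k hk => (hc k hk).const_smul _)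
    fun t ht => ?_
  rw [uIcc_of_le hT] at ht
  simp only [hG t ht x, smul_eq_mul, mul_comm]

/-- With finitely many coefficients, the exceptional null set of times can be chosen independently
of x. -/
lemma separated_deriv (hT : 0 ≤ T) (hc : ∀ k ∈ I, AbsolutelyContinuousOnInterval (c k) 0 T)
    (hG : ∀ t ∈ Icc (0 : ℝ) T, ∀ x : ℝ, G t x = ∑ k ∈ I, c k t * φ k x) :
    ∀ᵐ s : ℝ, s ∈ Ioo 0 T → ∀ x, deriv (fun t => G t x) s = ∑ k ∈ I, deriv (c k) s * φ k x := by
  have h : ∀ᵐ s : ℝ, ∀ k ∈ I, s ∈ uIcc 0 T → DifferentiableAt ℝ (c k) s :=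
    (Finset.eventually_all I).2 fun k hk => ac_ae_differentiableAt (hc k hk)
  filter_upwards [h] with s hs hsm x
  have hev : (fun t => G t x) =ᶠ[𝓝 s] fun t => ∑ k ∈ I, c k t * φ k x := by
    filter_upwards [Ioo_mem_nhds hsm.1 hsm.2] with t ht using hG t (Ioo_subset_Icc_self ht) x
  rw [hev.deriv_eq]
  refine HasDerivAt.deriv (HasDerivAt.fun_sum fun k hk => ?_)
  exact ((hs k hk (by rw [uIcc_of_le hT]; exact Ioo_subset_Icc_self hsm)).hasDerivAt).mul_const _

lemma separated_bounded (hT : 0 ≤ T) (hc : ∀ k ∈ I, AbsolutelyContinuousOnInterval (c k) 0 T)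
    (hφ : ∀ k ∈ I, φ k ∈ lipschitzVanish a b)
    (hG : ∀ t ∈ Icc (0 : ℝ) T, ∀ x : ℝ, G t x = ∑ k ∈ I, c k t * φ k x) :
    ∃ C, ∀ t ∈ Icc 0 T, ∀ x ∈ Ioo a b, ‖G t x‖ ≤ C := by
  choose! C hC using fun k hk => (hc k hk).exists_bound
  choose! D hD using fun k hk => lipschitzVanish_bounded (hφ k hk)
  refine ⟨∑ k ∈ I, C k * D k, fun t ht x hx => ?_⟩
  rw [hG t ht x]
  refine (norm_sum_le _ _).trans (Finset.sum_le_sum fun k hk => ?_)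
  rw [norm_mul]
  have h1 := hC k hk t (by rwa [uIcc_of_le hT])
  exact mul_le_mul h1 (hD k hk x hx) (norm_nonneg _) ((norm_nonneg _).trans h1)

lemma aestronglyMeasurable_coeff (hT : 0 ≤ T) {f : ℝ → ℂ}
    (hf : AbsolutelyContinuousOnInterval f 0 T) :
    AEStronglyMeasurable f (volume.restrict (Ioc 0 T)) := by
  have := hf.continuousOn
  rw [uIcc_of_le hT] at this
  exact (this.mono Ioc_subset_Icc_self).aestronglyMeasurable measurableSet_Ioc

lemma separated_aestronglyMeasurable (hT : 0 ≤ T)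
    (hc : ∀ k ∈ I, AbsolutelyContinuousOnInterval (c k) 0 T)
    (hφ : ∀ k ∈ I, φ k ∈ lipschitzVanish a b)
    (hG : ∀ t ∈ Icc (0 : ℝ) T, ∀ x : ℝ, G t x = ∑ k ∈ I, c k t * φ k x) :
    AEStronglyMeasurable (fun z : ℝ × ℝ => G z.1 z.2)
      ((volume.restrict (Ioc 0 T)).prod (volume.restrict (Ioo a b))) := by
  have h : AEStronglyMeasurable (fun z : ℝ × ℝ => ∑ k ∈ I, c k z.1 * φ k z.2)
      ((volume.restrict (Ioc 0 T)).prod (volume.restrict (Ioo a b))) :=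
    Finset.aestronglyMeasurable_fun_sum I fun k hk =>
      (aestronglyMeasurable_coeff hT (hc k hk)).comp_fst.mul
        (lipschitzVanish_aestronglyMeasurable (hφ k hk)).comp_snd
  refine h.congr ?_
  have hmem : ∀ᵐ z ∂((volume.restrict (Ioc 0 T)).prod (volume.restrict (Ioo a b))),
      z.1 ∈ Ioc 0 T := Measure.quasiMeasurePreserving_fst.ae (ae_restrict_mem measurableSet_Ioc)
  filter_upwards [hmem] with z hz
  exact (hG z.1 (Ioc_subset_Icc_self hz) z.2).symm

lemma separated_integrable_caputo {γ : ℝ} (hγ1 : γ < 1) (hT : 0 ≤ T)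
    (hc : ∀ k ∈ I, AbsolutelyContinuousOnInterval (c k) 0 T)
    (hφ : ∀ k ∈ I, φ k ∈ lipschitzVanish a b)
    (hG : ∀ t ∈ Icc (0 : ℝ) T, ∀ x : ℝ, G t x = ∑ k ∈ I, c k t * φ k x)
    {p : ℂ} {U : ℝ → ℝ} (hU : IntegrableOn U (Ioo a b))
    (hpU : ∀ x ∈ Ioo a b, 0 ≤ (p * (U x : ℂ)).re) :
    Integrable (fun z : ℝ × ℝ => caputoSubstantial γ p U G z.1 z.2 * (starRingEnd ℂ) (G z.1 z.2))
      ((volume.restrict (Ioc 0 T)).prod (volume.restrict (Ioo a b))) := by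
  obtain ⟨C, hC⟩ := separated_bounded hT hc hφ hG
  have hGm := separated_aestronglyMeasurable hT hc hφ hG
  set q : ℝ → ℂ := fun x => p * U x with hqdef
  have hqi : IntegrableOn q (Ioo a b) := hU.ofReal.const_mul p
  set E : ℝ → ℝ → ℂ := fun s x => ∑ k ∈ I, (deriv (c k) s + q x * c k s) * φ k x with hEdef
  choose! D hD using fun k hk => lipschitzVanish_bounded (hφ k hk)
  have hE : AEStronglyMeasurable (fun z : (ℝ × ℝ) × ℝ => E z.2 z.1.2)
      (((volume.restrict (Ioc 0 T)).prod (volume.restrict (Ioo a b))).prod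
        (volume.restrict (Ioc 0 T))) :=
    Finset.aestronglyMeasurable_fun_sum I fun k hk =>
      ((measurable_deriv (c k)).aestronglyMeasurable.comp_snd.add
        (hqi.1.comp_snd.comp_fst.mul (aestronglyMeasurable_coeff hT (hc k hk)).comp_snd)).mul
        (lipschitzVanish_aestronglyMeasurable (hφ k hk)).comp_snd.comp_fst
  have hm : IntegrableOn (fun x => 1 + ‖q x‖) (Ioo a b) :=
    (integrableOn_const (by simp)).add hqi.norm
  have hh : IntegrableOn (fun s => ∑ k ∈ I, (‖deriv (c k) s‖ + ‖c k s‖) * D k) (Ioc 0 T) := by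
    refine integrable_finsetSum I fun k hk => Integrable.mul_const ?_ _
    have h1 := (intervalIntegrable_iff_integrableOn_Ioc_of_le hT).1
      (ac_intervalIntegrable_deriv (hc k hk))
    have h2 := (intervalIntegrable_iff_integrableOn_Ioc_of_le hT).1
      ((hc k hk).continuousOn.intervalIntegrable (μ := volume))
    exact h1.norm.add h2.norm
  have hb : ∀ s ∈ Ioc 0 T, ∀ x ∈ Ioo a b, ‖E s x‖ ≤
      (1 + ‖q x‖) * ∑ k ∈ I, (‖deriv (c k) s‖ + ‖c k s‖) * D k := by
    intro s _ x hx
    rw [Finset.mul_sum]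
    refine (norm_sum_le _ _).trans (Finset.sum_le_sum fun k hk => ?_)
    rw [norm_mul, ← mul_assoc]
    refine mul_le_mul ?_ (hD k hk x hx) (norm_nonneg _) (by positivity)
    refine (norm_add_le _ _).trans ?_
    rw [norm_mul]
    nlinarith [norm_nonneg (deriv (c k) s), norm_nonneg (c k s), norm_nonneg (q x),
      mul_nonneg (norm_nonneg (q x)) (norm_nonneg (deriv (c k) s))]
  have key := integrable_tempered_singular (γ := γ) hγ1 measurableSet_Ioo hqi.1 hpU hE hm hh hb
  have hmem : ∀ᵐ z ∂((volume.restrict (Ioc 0 T)).prod (volume.restrict (Ioo a b))),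
      z.1 ∈ Ioc 0 T := Measure.quasiMeasurePreserving_fst.ae (ae_restrict_mem measurableSet_Ioc)
  have hmem2 : ∀ᵐ z ∂((volume.restrict (Ioc 0 T)).prod (volume.restrict (Ioo a b))),
      z.2 ∈ Ioo a b := Measure.quasiMeasurePreserving_snd.ae (ae_restrict_mem measurableSet_Ioo)
  have hd := separated_deriv hT hc hG
  have key2 := (key.const_mul (((Real.Gamma (1 - γ))⁻¹ : ℝ) : ℂ)).mul_bdd
    (Complex.continuous_conj.comp_aestronglyMeasurable hGm) (c := C) (by
      filter_upwards [hmem, hmem2] with z hz hz2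
      rw [RCLike.norm_conj]
      exact hC z.1 (Ioc_subset_Icc_self hz) z.2 hz2)
  refine key2.congr ?_
  filter_upwards [hmem] with z hz
  rw [caputoSubstantial_eq, substantialIntegral_eq_setIntegral (Ioc_subset_Icc_self hz) _
    (e := fun s => E s z.2)]
  filter_upwards [hd] with s h hs
  rw [h hs, hG s (Ioo_subset_Icc_self hs), hEdef, Finset.mul_sum, ← Finset.sum_add_distrib]
  refine Finset.sum_congr rfl fun k _ => ?_
  simp only [hqdef]; ring

end Separated

/-! ### Energy estimate -/

lemma prod_restrict_Ioc_mono {τ T : ℝ} (h : τ ≤ T) (ν : Measure ℝ) [SFinite ν] :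
    (volume.restrict (Ioc 0 τ)).prod ν ≤ (volume.restrict (Ioc 0 T)).prod ν :=
  Measure.prod_mono (Measure.restrict_mono (Ioc_subset_Ioc_right h) le_rfl) le_rfl

lemma integral_re_prod {μ ν : Measure ℝ} [SFinite μ] [SFinite ν] {F : ℝ × ℝ → ℂ}
    (hF : Integrable F (μ.prod ν)) :
    Integrable (fun t => (∫ x, F (t, x) ∂ν).re) μ ∧
      ∫ t, (∫ x, F (t, x) ∂ν).re ∂μ = ∫ x, ∫ t, (F (t, x)).re ∂μ ∂ν ∧
      ∫ t, (∫ x, F (t, x) ∂ν).re ∂μ = ∫ t, ∫ x, (F (t, x)).re ∂ν ∂μ := by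
  have e : ∫ t, (∫ x, F (t, x) ∂ν).re ∂μ = ∫ t, ∫ x, (F (t, x)).re ∂ν ∂μ := by
    refine integral_congr_ae ?_
    filter_upwards [hF.prod_right_ae] with t ht
    exact (Complex.reCLM.integral_comp_comm ht).symm
  refine ⟨hF.integral_prod_left.re, ?_, e⟩
  rw [e, integral_integral_swap (f := fun t x => (F (t, x)).re) hF.re]

section Separated

variable {a b T τ : ℝ} {ι : Type*} {I : Finset ι} {c : ι → ℝ → ℂ} {φ : ι → ℝ → ℂ}
  {G : ℝ → ℝ → ℂ}

lemma separated_integrable_sq (hT : 0 ≤ T)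
    (hc : ∀ k ∈ I, AbsolutelyContinuousOnInterval (c k) 0 T)
    (hφ : ∀ k ∈ I, φ k ∈ lipschitzVanish a b)
    (hG : ∀ t ∈ Icc (0 : ℝ) T, ∀ x : ℝ, G t x = ∑ k ∈ I, c k t * φ k x) :
    Integrable (fun z : ℝ × ℝ => ‖G z.1 z.2‖ ^ 2)
      ((volume.restrict (Ioc 0 T)).prod (volume.restrict (Ioo a b))) := by
  obtain ⟨C, hC⟩ := separated_bounded hT hc hφ hG
  have hmem : ∀ᵐ z ∂((volume.restrict (Ioc 0 T)).prod (volume.restrict (Ioo a b))),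
      z.1 ∈ Ioc 0 T := Measure.quasiMeasurePreserving_fst.ae (ae_restrict_mem measurableSet_Ioc)
  have hmem2 : ∀ᵐ z ∂((volume.restrict (Ioc 0 T)).prod (volume.restrict (Ioo a b))),
      z.2 ∈ Ioo a b := Measure.quasiMeasurePreserving_snd.ae (ae_restrict_mem measurableSet_Ioo)
  refine Integrable.of_bound ((separated_aestronglyMeasurable hT hc hφ hG).norm.pow 2) (C ^ 2) ?_
  filter_upwards [hmem, hmem2] with z hz hz2
  rw [norm_pow, norm_norm]
  gcongr
  exact hC z.1 (Ioc_subset_Icc_self hz) z.2 hz2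

lemma separated_integral_caputo_ge {γ : ℝ} (hγ : 0 < γ) (hγ1 : γ < 1) (hT : 0 ≤ T)
    (hc : ∀ k ∈ I, AbsolutelyContinuousOnInterval (c k) 0 T)
    (hφ : ∀ k ∈ I, φ k ∈ lipschitzVanish a b)
    (hG : ∀ t ∈ Icc (0 : ℝ) T, ∀ x : ℝ, G t x = ∑ k ∈ I, c k t * φ k x)
    {p : ℂ} {U : ℝ → ℝ} (hU : IntegrableOn U (Ioo a b))
    (hpU : ∀ x ∈ Ioo a b, 0 ≤ (p * (U x : ℂ)).re) (hτ : τ ∈ Icc 0 T) :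
    IntegrableOn (fun t => (l2Inner a b (caputoSubstantial γ p U G t) (G t)).re) (Ioc 0 τ) ∧
    (Real.Gamma (1 - γ))⁻¹ * ((T ^ (-γ) * (∫ s in Ioc 0 τ, l2Norm a b (G s) ^ 2) -
        T ^ (1 - γ) / (1 - γ) * l2Norm a b (G 0) ^ 2) / 2) ≤
      ∫ t in Ioc 0 τ, (l2Inner a b (caputoSubstantial γ p U G t) (G t)).re := by
  have hF := (separated_integrable_caputo hγ1 hT hc hφ hG hU hpU).mono_measure
    (prod_restrict_Ioc_mono hτ.2 _)
  have hN := (separated_integrable_sq hT hc hφ hG).mono_measure (prod_restrict_Ioc_mono hτ.2 _)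
  obtain ⟨h1, h2, -⟩ := integral_re_prod hF
  refine ⟨h1, ?_⟩
  simp only [l2Inner]
  rw [h2]
  have hΓ : 0 < Real.Gamma (1 - γ) := Real.Gamma_pos_of_pos (by linarith)
  have hN0 : IntegrableOn (fun x => ‖G 0 x‖ ^ 2) (Ioo a b) := by
    obtain ⟨C, hC⟩ := separated_bounded hT hc hφ hG
    have hm : AEStronglyMeasurable (fun x => G 0 x) (volume.restrict (Ioo a b)) := by
      have : (fun x => G 0 x) = fun x => ∑ k ∈ I, c k 0 * φ k x :=
        funext fun x => hG 0 ⟨le_rfl, hT⟩ x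
      rw [this]
      exact Finset.aestronglyMeasurable_fun_sum I fun k hk =>
        (lipschitzVanish_aestronglyMeasurable (hφ k hk)).const_mul _
    refine Integrable.of_bound (hm.norm.pow 2) (C ^ 2) ?_
    filter_upwards [ae_restrict_mem measurableSet_Ioo] with x hx
    rw [norm_pow, norm_norm]
    gcongr
    exact hC 0 ⟨le_rfl, hT⟩ x hx
  have hlow : (Real.Gamma (1 - γ))⁻¹ * ((T ^ (-γ) * (∫ s in Ioc 0 τ, l2Norm a b (G s) ^ 2) -
        T ^ (1 - γ) / (1 - γ) * l2Norm a b (G 0) ^ 2) / 2) =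
      ∫ x in Ioo a b, (Real.Gamma (1 - γ))⁻¹ * ((T ^ (-γ) * (∫ s in Ioc 0 τ, ‖G s x‖ ^ 2) -
        T ^ (1 - γ) / (1 - γ) * ‖G 0 x‖ ^ 2) / 2) := by
    simp_rw [l2Norm_sq]
    rw [integral_const_mul, integral_div, integral_sub (hN.integral_prod_right.const_mul _)
      (hN0.const_mul _), integral_const_mul, integral_const_mul,
      integral_integral_swap (f := fun t x => ‖G t x‖ ^ 2) hN]
  rw [hlow]
  refine integral_mono_ae (((((hN.integral_prod_right.const_mul _).sub
    (hN0.const_mul _)).div_const 2)).const_mul _) hF.re.integral_prod_right ?_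
  -- At fixed x the time estimate applies with q = pU(x), with constants that do not depend on x; it
  -- remains to integrate in x.
  filter_upwards [ae_restrict_mem measurableSet_Ioo] with x hx
  have hac := (separated_ac hT hc hG x).mono (c := 0) (d := τ) (by
    rw [uIcc_of_le hT, uIcc_of_le hτ.1]; exact Icc_subset_Icc_right hτ.2)
  have key := integral_substantialIntegral_ge hγ hγ1 hτ.1 hτ.2 (hpU x hx) hac
  have e : ∀ t, (caputoSubstantial γ p U G t x * (starRingEnd ℂ) (G t x)).re =
      (Real.Gamma (1 - γ))⁻¹ *
        (substantialIntegral γ (p * U x) (fun τ => G τ x) t * (starRingEnd ℂ) (G t x)).re :=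
    fun t => by rw [caputoSubstantial_eq, mul_assoc, Complex.re_ofReal_mul]
  change _ ≤ ∫ t in Ioc 0 τ, (caputoSubstantial γ p U G t x * (starRingEnd ℂ) (G t x)).re
  simp_rw [e]
  rw [integral_const_mul]
  exact mul_le_mul_of_nonneg_left key (inv_nonneg.2 hΓ.le)

lemma separated_integral_source_le (hT : 0 ≤ T)
    (hc : ∀ k ∈ I, AbsolutelyContinuousOnInterval (c k) 0 T)
    (hφ : ∀ k ∈ I, φ k ∈ lipschitzVanish a b)
    (hG : ∀ t ∈ Icc (0 : ℝ) T, ∀ x : ℝ, G t x = ∑ k ∈ I, c k t * φ k x)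
    {f : ℝ → ℝ → ℂ} (hf : MemLp (Function.uncurry f) 2
      ((volume.restrict (Ioo (0 : ℝ) T)).prod (volume.restrict (Ioo a b))))
    (hτ : τ ∈ Icc 0 T) {δ : ℝ} (hδ : 0 < δ) :
    IntegrableOn (fun t => l2Norm a b (G t) ^ 2) (Ioc 0 τ) ∧
    IntegrableOn (fun t => (l2Inner a b (f t) (G t)).re) (Ioc 0 τ) ∧
    ∫ t in Ioc 0 τ, (l2Inner a b (f t) (G t)).re ≤
      δ * (∫ t in Ioc 0 τ, l2Norm a b (G t) ^ 2) +
        (4 * δ)⁻¹ * ∫ t in Ioc 0 τ, l2Norm a b (f t) ^ 2 := by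
  rw [restrict_Ioo_eq_restrict_Ioc] at hf
  have hfm := hf.1.mono_measure (prod_restrict_Ioc_mono hτ.2 _)
  have hf2 : Integrable (fun z : ℝ × ℝ => ‖f z.1 z.2‖ ^ 2)
      ((volume.restrict (Ioc 0 τ)).prod (volume.restrict (Ioo a b))) :=
    ((memLp_two_iff_integrable_sq_norm hf.1).1 hf).mono_measure (prod_restrict_Ioc_mono hτ.2 _)
  have hN := (separated_integrable_sq hT hc hφ hG).mono_measure (prod_restrict_Ioc_mono hτ.2
    (volume.restrict (Ioo a b)))
  have hGm := (separated_aestronglyMeasurable hT hc hφ hG).mono_measure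
    (prod_restrict_Ioc_mono hτ.2 (volume.restrict (Ioo a b)))
  have hmaj : Integrable (fun z : ℝ × ℝ => δ * ‖G z.1 z.2‖ ^ 2 + (4 * δ)⁻¹ * ‖f z.1 z.2‖ ^ 2)
      ((volume.restrict (Ioc 0 τ)).prod (volume.restrict (Ioo a b))) :=
    (hN.const_mul _).add (hf2.const_mul _)
  have hyoung : ∀ u v : ℂ, ‖u * (starRingEnd ℂ) v‖ ≤ δ * ‖v‖ ^ 2 + (4 * δ)⁻¹ * ‖u‖ ^ 2 := by
    intro u v
    rw [norm_mul, RCLike.norm_conj]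
    have : δ * ‖v‖ ^ 2 + (4 * δ)⁻¹ * ‖u‖ ^ 2 - ‖u‖ * ‖v‖ =
        (4 * δ)⁻¹ * (‖u‖ - 2 * δ * ‖v‖) ^ 2 := by
      field_simp; ring
    have h2 : 0 ≤ (4 * δ)⁻¹ * (‖u‖ - 2 * δ * ‖v‖) ^ 2 := by positivity
    linarith
  have hF : Integrable (fun z : ℝ × ℝ => f z.1 z.2 * (starRingEnd ℂ) (G z.1 z.2))
      ((volume.restrict (Ioc 0 τ)).prod (volume.restrict (Ioo a b))) :=
    hmaj.mono' (hfm.mul (Complex.continuous_conj.comp_aestronglyMeasurable hGm))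
      (Eventually.of_forall fun z => hyoung _ _)
  obtain ⟨h1, -, h3⟩ := integral_re_prod hF
  refine ⟨?_, h1, ?_⟩
  · simp_rw [l2Norm_sq]
    exact hN.integral_prod_left
  · have e : δ * (∫ t in Ioc 0 τ, l2Norm a b (G t) ^ 2) +
        (4 * δ)⁻¹ * (∫ t in Ioc 0 τ, l2Norm a b (f t) ^ 2) =
        ∫ t in Ioc 0 τ, ∫ x in Ioo a b, δ * ‖G t x‖ ^ 2 + (4 * δ)⁻¹ * ‖f t x‖ ^ 2 := by
      simp_rw [l2Norm_sq]
      rw [← integral_const_mul, ← integral_const_mul, ← integral_add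
        (hN.integral_prod_left.const_mul _) (hf2.integral_prod_left.const_mul _)]
      refine integral_congr_ae ?_
      filter_upwards [hN.prod_right_ae, hf2.prod_right_ae] with t ht1 ht2
      rw [integral_add (ht1.const_mul _) (ht2.const_mul _), integral_const_mul, integral_const_mul]
    simp only [l2Inner]
    rw [h3, e]
    refine integral_mono_ae hF.re.integral_prod_left hmaj.integral_prod_left ?_
    filter_upwards [hF.prod_right_ae, hmaj.prod_right_ae] with t ht1 ht2
    exact integral_mono ht1.re ht2 fun x => (Complex.re_le_norm _).trans (hyoung _ _)

end Separated

end FeynmanKac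

/-! ### The stability estimate -/

theorem mainTheorem4 (a b α γ K T M : ℝ) (hab : a < b) (hα : 1 < α) (hα2 : α < 2)
    (hγ : 0 < γ) (hγ1 : γ < 1) (hK : 0 < K) (hT : 0 < T) :
    ∃ C : ℝ, 0 < C ∧
      ∀ (d J : ℕ), 2 ≤ d →
      ∀ (p : ℂ) (U : ℝ → ℝ), IntegrableOn U (Ioo a b) →
        (∀ x ∈ Ioo a b, 0 ≤ (p * (U x : ℂ)).re) →
      ∀ (g : ℝ → ℂ), MemLp g 2 (volume.restrict (Ioo a b)) →
      ∀ (f : ℝ → ℝ → ℂ),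
        MemLp (Function.uncurry f) 2
          ((volume.restrict (Ioo (0 : ℝ) T)).prod (volume.restrict (Ioo a b))) →
      ∀ (G : ℝ → ℝ → ℂ), FeynmanKac.IsSemiDiscreteSolution a b α γ K T d J p U f G →
        FeynmanKac.l2Norm a b (G 0) ≤ M * FeynmanKac.l2Norm a b g →
      ∀ t ∈ Icc (0 : ℝ) T,
        IntervalIntegrable (fun s : ℝ => FeynmanKac.l2Norm a b (G s) ^ 2 +
          K * (FeynmanKac.rieszForm a b α (G s) (G s)).re) volume 0 t ∧
        (∫ s in (0 : ℝ)..t, (FeynmanKac.l2Norm a b (G s) ^ 2 +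
            K * (FeynmanKac.rieszForm a b α (G s) (G s)).re)) ≤
          C * (FeynmanKac.l2Norm a b g ^ 2 +
            ∫ s in (0 : ℝ)..t, FeynmanKac.l2Norm a b (f s) ^ 2) := by
  open FeynmanKac in
  have hΓ : 0 < Real.Gamma (1 - γ) := Real.Gamma_pos_of_pos (by linarith)
  have hγ' : 0 < 1 - γ := by linarith
  set A : ℝ := (Real.Gamma (1 - γ))⁻¹ * T ^ (-γ) / 2 with hA
  set B : ℝ := (Real.Gamma (1 - γ))⁻¹ * (T ^ (1 - γ) / (1 - γ)) / 2 with hB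
  have hA0 : 0 < A := by positivity
  have hB0 : 0 < B := by positivity
  -- The first summand pays for the initial value, the second for the source: Young's inequality
  -- with δ = A/2 has constant (4δ)⁻¹ = (2A)⁻¹.
  set R : ℝ := B * M ^ 2 + (2 * A)⁻¹ with hR
  have hR0 : 0 < R := by positivity
  refine ⟨(1 + 2 / A) * R, by positivity, ?_⟩
  intro d J hd p U hU hpU g _ f hf G hsol hM t ht
  obtain ⟨c, hc, hG⟩ := hsol.trial
  have hφ : ∀ k ∈ scalingIndex d J, scaling a b d J k ∈ lipschitzVanish a b :=
    fun k hk => scaling_mem hab hd hk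
  obtain ⟨hW, hWge⟩ := separated_integral_caputo_ge hγ hγ1 hT.le hc hφ hG hU hpU ht
  -- The choice δ = A/2 leaves half of the coercive term A∫‖G‖² on the left.
  obtain ⟨hN, hP, hPle⟩ := separated_integral_source_le hT.le hc hφ hG hf ht (half_pos hA0)
  have hGmem : ∀ s ∈ Icc 0 T, G s ∈ splineSpace a b d J := fun s hs => by
    have : G s = ∑ k ∈ scalingIndex d J, c k s • scaling a b d J k := by
      funext x
      simp [hG s hs x, Finset.sum_apply]
    rw [this]
    exact Submodule.sum_mem _ fun k hk => Submodule.smul_mem _ _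
      (Submodule.subset_span ⟨k, hk, rfl⟩)
  have hweak : ∀ᵐ s ∂(volume.restrict (Ioc 0 t)),
      K * (rieszForm a b α (G s) (G s)).re = (l2Inner a b (f s) (G s)).re -
        (l2Inner a b (caputoSubstantial γ p U G s) (G s)).re := by
    have h := hsol.weak
    rw [restrict_Ioo_eq_restrict_Ioc] at h
    filter_upwards [ae_restrict_of_ae_restrict_of_subset (Ioc_subset_Ioc_right ht.2) h,
      ae_restrict_mem measurableSet_Ioc] with s hs hsm
    have e := congrArg Complex.re (hs (G s) (hGmem s ⟨hsm.1.le, hsm.2.trans ht.2⟩))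
    rw [Complex.add_re, Complex.re_ofReal_mul] at e
    linarith
  -- Integrability of the Riesz term in time is read off from the equation, as a difference of two
  -- integrable functions.
  have hRi : IntegrableOn (fun s => K * (rieszForm a b α (G s) (G s)).re) (Ioc 0 t) :=
    (hP.sub hW).congr (by filter_upwards [hweak] with s hs using hs.symm)
  have hRint : ∫ s in Ioc 0 t, K * (rieszForm a b α (G s) (G s)).re =
      (∫ s in Ioc 0 t, (l2Inner a b (f s) (G s)).re) -
        ∫ s in Ioc 0 t, (l2Inner a b (caputoSubstantial γ p U G s) (G s)).re := by
    rw [integral_congr_ae hweak, integral_sub hP hW]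
  have hRnn : 0 ≤ ∫ s in Ioc 0 t, K * (rieszForm a b α (G s) (G s)).re :=
    setIntegral_nonneg measurableSet_Ioc fun s hs => mul_nonneg hK.le
      (rieszForm_re_nonneg hab.le hα hα2
        (splineSpace_le hab hd J (hGmem s ⟨hs.1.le, hs.2.trans ht.2⟩)))
  refine ⟨(intervalIntegrable_iff_integrableOn_Ioc_of_le ht.1).2 (hN.add hRi), ?_⟩
  rw [intervalIntegral.integral_of_le ht.1, intervalIntegral.integral_of_le ht.1,
    integral_add hN hRi]
  have hNnn : 0 ≤ ∫ s in Ioc 0 t, l2Norm a b (G s) ^ 2 := integral_nonneg fun _ => sq_nonneg _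
  have hFnn : 0 ≤ ∫ s in Ioc 0 t, l2Norm a b (f s) ^ 2 := integral_nonneg fun _ => sq_nonneg _
  have hM2 : l2Norm a b (G 0) ^ 2 ≤ M ^ 2 * l2Norm a b g ^ 2 := by
    rw [← mul_pow]
    exact pow_le_pow_left₀ (Real.sqrt_nonneg _) hM 2
  set N := ∫ s in Ioc 0 t, l2Norm a b (G s) ^ 2
  set Q := ∫ s in Ioc 0 t, K * (rieszForm a b α (G s) (G s)).re
  set F := ∫ s in Ioc 0 t, l2Norm a b (f s) ^ 2
  have h1 : A * N - B * l2Norm a b (G 0) ^ 2 ≤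
      ∫ s in Ioc 0 t, (l2Inner a b (caputoSubstantial γ p U G s) (G s)).re := by
    refine le_trans (le_of_eq ?_) hWge
    rw [hA, hB]; ring
  have h2 : (4 * (A / 2))⁻¹ = (2 * A)⁻¹ := by congr 1; ring
  rw [h2] at hPle
  have h3 : Q + A / 2 * N ≤ R * (l2Norm a b g ^ 2 + F) := by
    have h4 := mul_le_mul_of_nonneg_left hM2 hB0.le
    have h5 : 0 ≤ B * M ^ 2 * F := by positivity
    have h6 : 0 ≤ (2 * A)⁻¹ * l2Norm a b g ^ 2 := by positivity
    have h7 : R * (l2Norm a b g ^ 2 + F) = B * (M ^ 2 * l2Norm a b g ^ 2) + (2 * A)⁻¹ * F +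
        B * M ^ 2 * F + (2 * A)⁻¹ * l2Norm a b g ^ 2 := by rw [hR]; ring
    linarith
  -- The factor 1 + 2/A recovers the full Q from its first summand and the full N from its second;
  -- the leftover terms are nonnegative because Q and N are.
  have h8 : N + Q ≤ (1 + 2 / A) * (Q + A / 2 * N) := by
    have e : (1 + 2 / A) * (Q + A / 2 * N) = N + Q + (2 / A * Q + A / 2 * N) := by
      field_simp; ring
    have : 0 ≤ 2 / A * Q + A / 2 * N := by positivity
    linarith
  calc N + Q ≤ (1 + 2 / A) * (Q + A / 2 * N) := h8
    _ ≤ (1 + 2 / A) * (R * (l2Norm a b g ^ 2 + F)) := by gcongr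
    _ = _ := by ring
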